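/- Let $(\Omega,\Sigma,\mu)$ be an arbitrary measure space and let $\mathcal F$ be a finite collection (repeated elements allowed) of sets in $\Sigma$ with $0<\mu(Q)<\infty$ for all $Q\in\mathcal F$. Suppose that $\mathcal F$ satisfies the $\Lambda$-Carleson condition for some $\Lambda\ge 1$, i.e. $\sum_{Q\in\mathcal A}\mu(Q)\le\Lambda\,\mu\big(\bigcup_{Q\in\mathcal A}Q\big)$ for every $\mathcal A\subseteq\mathcal F$. For $\mathcal A\subseteq\mathcal F$ let $E_{\mathcal A}=\bigcap_{Q\in\mathcal A}Q\cap\bigcap_{Q\in\mathcal F\setminus\mathcal A}(\Omega\setminus Q)$, and let $\mathcal P_0(\mathcal F)$ be the set of all nonempty $\mathcal A\subseteq\mathcal F$ with $E_{\mathcal A}\ne\emptyset$. Let $G$ be the directed graph with vertices $s$, $t$, $v_Q$ ($Q\in\mathcal F$) and $v_{\mathcal A}$ ($\mathcal A\in\mathcal P_0(\mathcal F)$), and with the edges $(s,v_{\mathcal A})$ of capacity $\mu(E_{\mathcal A})$, $(v_{\mathcal A},v_Q)$ of capacity $\infty$ for $Q\in\mathcal A$, and $(v_Q,t)$ of capacity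 $\Lambda^{-1}\mu(Q)$. A flow is a function $f$ from the edges to $[0,\infty)$ that is bounded by the capacities and conserved at every vertex other than $s,t$; its value is $\sum_{\mathcal A}f(s,v_{\mathcal A})$. For a flow $f$ put $$\varphi_Q=\sum_{\mathcal A\in\mathcal P_0(\mathcal F):\,Q\in\mathcal A}\frac{f(v_{\mathcal A},v_Q)}{\mu(E_{\mathcal A})}\mathbf 1_{E_{\mathcal A}},\qquad Q\in\mathcal F,$$ where $0/0$ is read as $0$. Then: 1. $G$ has a flow $f$ of maximum value from $s$ to $t$, and for every such $f$ the functions $\varphi_Q$ are measurable with values in $[0,1]$ and satisfy $$\int_Q\varphi_Q\,d\mu\ge\tfrac1\Lambda\,\mu(Q)\quad(Q\in\mathcal F),\qquad \sum_{Q\in\mathcal F}\varphi_Q\le 1\ \text{ on }\Omega .$$ In particular $\mathcal F$ is generalized $\frac1\Lambda$-sparse, that is, measurable functions $\varphi_Q\colon\Omega\to[0,1]$ with these two properties exist. 2. There is one algorithm (a program of a uniform-cost random access machine with integer and exact real cells) which, for every such nonempty $\mathcal F$, given a list of the elements of $\mathcal P_0(\mathcal F)$, the number $\Lambda$ and an oracle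 that returns $\mu\big(\bigcup_{Q\in\mathcal A}Q\big)$ for a queried $\mathcal A\subseteq\mathcal F$, computes the values on the sets $E_{\mathcal A}$ of the functions $\varphi_Q$ of some maximum flow on $G$. With $n=|\mathcal F|$, $m=|\mathcal P_0(\mathcal F)|$ and $\mathrm{EO}_1$ the time of one oracle call, its runtime is $$O\big(m\cdot\mathrm{EO}_1+n^2m+nm^2\big),$$ with an absolute implied constant. -/

import Mathlib

open MeasureTheory
open scoped ENNReal NNReal

namespace CarlesonFlow

/-! ## Collections of sets

A finite collection of `n` sets, repetitions allowed, is a family `Q : Fin n → Set Ω`;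
a subcollection is a `Finset (Fin n)`. -/

/-- The `Λ`-Carleson condition, for `Λ ≥ 1`. -/
def IsCarleson {Ω : Type*} [MeasurableSpace Ω] (μ : Measure Ω) {n : ℕ} (Q : Fin n → Set Ω)
    (Λ : ℝ) : Prop :=
  1 ≤ Λ ∧ ∀ A : Finset (Fin n),
    ∑ j ∈ A, μ (Q j) ≤ ENNReal.ofReal Λ * μ (⋃ j ∈ A, Q j)

/-- The functions `φ j : Ω → [0, 1]` witness that the collection is generalized `η`-sparse.
The functions take values in `[0, 1]`, so their integrals are written as lower integrals. -/
structure IsSparseWitness {Ω : Type*} [MeasurableSpace Ω] (μ : Measure Ω) {n : ℕ}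
    (Q : Fin n → Set Ω) (η : ℝ) (φ : Fin n → Ω → ℝ) : Prop where
  measurable : ∀ j, Measurable (φ j)
  mem_Icc : ∀ j x, φ j x ∈ Set.Icc (0 : ℝ) 1
  le_integral : ∀ j, ENNReal.ofReal η * μ (Q j) ≤ ∫⁻ x in Q j, ENNReal.ofReal (φ j x) ∂μ
  sum_le_one : ∀ x, ∑ j, φ j x ≤ 1

/-- Generalized `η`-sparseness, for `η ∈ (0, 1]`. -/
def IsGeneralizedSparse {Ω : Type*} [MeasurableSpace Ω] (μ : Measure Ω) {n : ℕ}
    (Q : Fin n → Set Ω) (η : ℝ) : Prop :=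
  0 < η ∧ η ≤ 1 ∧ ∃ φ : Fin n → Ω → ℝ, IsSparseWitness μ Q η φ

/-- The set `E_A` of the points that lie in the sets of `A` and in no other set of the
collection. -/
def atom {Ω : Type*} {n : ℕ} (Q : Fin n → Set Ω) (A : Finset (Fin n)) : Set Ω :=
  (⋂ j ∈ A, Q j) ∩ ⋂ j ∈ Aᶜ, (Q j)ᶜ

open Classical in
/-- The subcollections `A` with `E_A ≠ ∅`, where the ambient space is taken to be the union of
the collection: `A = ∅`, whose `E_A` is the complement of that union, is left out. -/
noncomputable def P0 {Ω : Type*} {n : ℕ} (Q : Fin n → Set Ω) : Finset (Finset (Fin n)) :=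
  {A | A.Nonempty ∧ (atom Q A).Nonempty}

/-! ## Networks and flows -/

/-- A weighted directed graph with a source and a sink. Only the values of `cap` on edges
matter. -/
structure Network (V : Type*) where
  source : V
  sink : V
  Edge : V → V → Prop
  cap : V → V → ℝ≥0∞

/-- A flow `E → [0, ∞)`, extended by zero to all pairs of vertices. -/
structure Network.IsFlow {V : Type*} [Fintype V] (G : Network V) (f : V → V → ℝ≥0) : Prop where
  eq_zero : ∀ u v, ¬ G.Edge u v → f u v = 0
  conservation : ∀ v, v ≠ G.source → v ≠ G.sink → ∑ u, f u v = ∑ w, f v w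
  le_cap : ∀ u v, G.Edge u v → (f u v : ℝ≥0∞) ≤ G.cap u v

/-- The value of a flow. -/
def Network.value {V : Type*} [Fintype V] (G : Network V) (f : V → V → ℝ≥0) : ℝ≥0 :=
  ∑ v, f G.source v

/-- A maximum flow. -/
def Network.IsMaxFlow {V : Type*} [Fintype V] (G : Network V) (f : V → V → ℝ≥0) : Prop :=
  G.IsFlow f ∧ ∀ g, G.IsFlow g → G.value g ≤ G.value f

/-- The vertices of the graph built from a collection: a source, a sink, a vertex for each set
of the collection and a vertex for each `A ∈ P0 Q`. -/
inductive Vertex {Ω : Type*} {n : ℕ} (Q : Fin n → Set Ω) where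
  | source : Vertex Q
  | sink : Vertex Q
  | ofSet (j : Fin n) : Vertex Q
  | ofAtom (A : {A // A ∈ P0 Q}) : Vertex Q

/-- The vertices listed as a sum type. -/
noncomputable def Vertex.equivSum {Ω : Type*} {n : ℕ} (Q : Fin n → Set Ω) :
    (Unit ⊕ Unit) ⊕ (Fin n ⊕ {A // A ∈ P0 Q}) ≃ Vertex Q where
  toFun
    | .inl (.inl _) => .source
    | .inl (.inr _) => .sink
    | .inr (.inl j) => .ofSet j
    | .inr (.inr A) => .ofAtom A
  invFun
    | .source => .inl (.inl ())
    | .sink => .inl (.inr ())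
    | .ofSet j => .inr (.inl j)
    | .ofAtom A => .inr (.inr A)
  left_inv := by rintro ((_ | _) | (_ | _)) <;> rfl
  right_inv := by rintro (_ | _ | _ | _) <;> rfl

noncomputable instance Vertex.instFintype {Ω : Type*} {n : ℕ} (Q : Fin n → Set Ω) : Fintype (Vertex Q) :=
  Fintype.ofEquiv _ (Vertex.equivSum Q)

/-- The edges `source → A` with `A ∈ P0 Q`, `A → j` with `j ∈ A`, and `j → sink`. -/
noncomputable def graphEdge {Ω : Type*} {n : ℕ} (Q : Fin n → Set Ω) : Vertex Q → Vertex Q → Prop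
  | .source, .ofAtom _ => True
  | .ofAtom A, .ofSet j => j ∈ A.1
  | .ofSet _, .sink => True
  | _, _ => False

/-- The capacities `μ (E_A)`, `∞` and `Λ⁻¹ μ (Q j)` of the three kinds of edges. -/
noncomputable def graphCap {Ω : Type*} [MeasurableSpace Ω] (μ : Measure Ω) {n : ℕ}
    (Q : Fin n → Set Ω) (Λ : ℝ) : Vertex Q → Vertex Q → ℝ≥0∞
  | .source, .ofAtom A => μ (atom Q A.1)
  | .ofAtom _, .ofSet _ => ∞
  | .ofSet j, .sink => ENNReal.ofReal Λ⁻¹ * μ (Q j)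
  | _, _ => 0

/-- The graph built from the sets `E_A` of a collection and the constant `Λ`. -/
noncomputable def graph {Ω : Type*} [MeasurableSpace Ω] (μ : Measure Ω) {n : ℕ}
    (Q : Fin n → Set Ω) (Λ : ℝ) : Network (Vertex Q) where
  source := .source
  sink := .sink
  Edge := graphEdge Q
  cap := graphCap μ Q Λ

/-- `φ_j = ∑_{A ∋ j} f(A, j) / μ(E_A) · 1_{E_A}`. A term with `μ (E_A) = 0` is zero: there a flow
has `f(A, j) = 0`, and `0 / 0` is read as `0`. -/
noncomputable def phi {Ω : Type*} [MeasurableSpace Ω] (μ : Measure Ω) {n : ℕ}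
    (Q : Fin n → Set Ω) (f : Vertex Q → Vertex Q → ℝ≥0) (j : Fin n) (x : Ω) : ℝ :=
  ∑ A : {A // A ∈ P0 Q} with j ∈ A.1,
    (f (.ofAtom A) (.ofSet j) : ℝ) / μ.real (atom Q A.1) * (atom Q A.1).indicator 1 x

/-! ## A real random access machine with an oracle

Programs of a uniform cost random access machine with integer cells (used for indices) and
exact real cells. The memory consists of variables and of arrays of each kind; a program names
finitely many of them, and array cells are addressed by computed indices. Each access, each
integer addition or subtraction, each real arithmetic operation and each comparison is one
step. -/

structure State where
  natVar : ℕ → ℕ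
  natArr : ℕ → ℕ → ℕ
  realVar : ℕ → ℝ
  realArr : ℕ → ℕ → ℝ

inductive NatExpr where
  | const (k : ℕ)
  | var (i : ℕ)
  | read (a : ℕ) (e : NatExpr)
  | add (e₁ e₂ : NatExpr)
  | sub (e₁ e₂ : NatExpr)

/-- Subtraction of naturals is truncated at zero. -/
def NatExpr.eval (s : State) : NatExpr → ℕ
  | .const k => k
  | .var i => s.natVar i
  | .read a e => s.natArr a (e.eval s)
  | .add e₁ e₂ => e₁.eval s + e₂.eval s
  | .sub e₁ e₂ => e₁.eval s - e₂.eval s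

def NatExpr.cost : NatExpr → ℕ
  | .const _ => 1
  | .var _ => 1
  | .read _ e => e.cost + 1
  | .add e₁ e₂ => e₁.cost + e₂.cost + 1
  | .sub e₁ e₂ => e₁.cost + e₂.cost + 1

inductive RealExpr where
  | const (q : ℚ)
  | var (i : ℕ)
  | read (a : ℕ) (e : NatExpr)
  | add (e₁ e₂ : RealExpr)
  | sub (e₁ e₂ : RealExpr)
  | mul (e₁ e₂ : RealExpr)
  | div (e₁ e₂ : RealExpr)

/-- Division by zero returns zero (one comparison would detect it). -/
noncomputable def RealExpr.eval (s : State) : RealExpr → ℝ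
  | .const q => (q : ℝ)
  | .var i => s.realVar i
  | .read a e => s.realArr a (e.eval s)
  | .add e₁ e₂ => e₁.eval s + e₂.eval s
  | .sub e₁ e₂ => e₁.eval s - e₂.eval s
  | .mul e₁ e₂ => e₁.eval s * e₂.eval s
  | .div e₁ e₂ => e₁.eval s / e₂.eval s

def RealExpr.cost : RealExpr → ℕ
  | .const _ => 1
  | .var _ => 1
  | .read _ e => e.cost + 1
  | .add e₁ e₂ => e₁.cost + e₂.cost + 1
  | .sub e₁ e₂ => e₁.cost + e₂.cost + 1
  | .mul e₁ e₂ => e₁.cost + e₂.cost + 1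
  | .div e₁ e₂ => e₁.cost + e₂.cost + 1

inductive Cond where
  | natEq (e₁ e₂ : NatExpr)
  | natLt (e₁ e₂ : NatExpr)
  | realEq (e₁ e₂ : RealExpr)
  | realLt (e₁ e₂ : RealExpr)
  | not (b : Cond)
  | and (b₁ b₂ : Cond)

def Cond.Holds (s : State) : Cond → Prop
  | .natEq e₁ e₂ => e₁.eval s = e₂.eval s
  | .natLt e₁ e₂ => e₁.eval s < e₂.eval s
  | .realEq e₁ e₂ => e₁.eval s = e₂.eval s
  | .realLt e₁ e₂ => e₁.eval s < e₂.eval s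
  | .not b => ¬ b.Holds s
  | .and b₁ b₂ => b₁.Holds s ∧ b₂.Holds s

def Cond.cost : Cond → ℕ
  | .natEq e₁ e₂ => e₁.cost + e₂.cost + 1
  | .natLt e₁ e₂ => e₁.cost + e₂.cost + 1
  | .realEq e₁ e₂ => e₁.cost + e₂.cost + 1
  | .realLt e₁ e₂ => e₁.cost + e₂.cost + 1
  | .not b => b.cost + 1
  | .and b₁ b₂ => b₁.cost + b₂.cost + 1

inductive Prog where
  | skip
  | setNat (i : ℕ) (e : NatExpr)
  | writeNat (a : ℕ) (idx e : NatExpr)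
  | setReal (i : ℕ) (e : RealExpr)
  | writeReal (a : ℕ) (idx : NatExpr) (e : RealExpr)
  | query (i : ℕ) (a : ℕ)
  | seq (p₁ p₂ : Prog)
  | ite (b : Cond) (p₁ p₂ : Prog)
  | while (b : Cond) (p : Prog)

/-- `Exec O p s s' t c`: with oracle `O`, the program `p` started in the state `s` halts in the
state `s'` after `t` steps and `c` oracle calls. The oracle is handed the contents of an integer
array and returns a real number; the time of its own computation is not part of `t`. -/
inductive Exec (O : (ℕ → ℕ) → ℝ) : Prog → State → State → ℕ → ℕ → Prop
  | skip (s : State) : Exec O .skip s s 1 0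
  | setNat (s : State) (i : ℕ) (e : NatExpr) :
      Exec O (.setNat i e) s { s with natVar := Function.update s.natVar i (e.eval s) }
        (e.cost + 1) 0
  | writeNat (s : State) (a : ℕ) (idx e : NatExpr) :
      Exec O (.writeNat a idx e) s
        { s with natArr := Function.update s.natArr a
                  (Function.update (s.natArr a) (idx.eval s) (e.eval s)) }
        (idx.cost + e.cost + 1) 0
  | setReal (s : State) (i : ℕ) (e : RealExpr) :
      Exec O (.setReal i e) s { s with realVar := Function.update s.realVar i (e.eval s) }
        (e.cost + 1) 0
  | writeReal (s : State) (a : ℕ) (idx : NatExpr) (e : RealExpr) :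
      Exec O (.writeReal a idx e) s
        { s with realArr := Function.update s.realArr a
                  (Function.update (s.realArr a) (idx.eval s) (e.eval s)) }
        (idx.cost + e.cost + 1) 0
  | query (s : State) (i a : ℕ) :
      Exec O (.query i a) s { s with realVar := Function.update s.realVar i (O (s.natArr a)) } 1 1
  | seq {p₁ p₂ : Prog} {s₁ s₂ s₃ : State} {t₁ t₂ c₁ c₂ : ℕ} :
      Exec O p₁ s₁ s₂ t₁ c₁ → Exec O p₂ s₂ s₃ t₂ c₂ →
      Exec O (.seq p₁ p₂) s₁ s₃ (t₁ + t₂) (c₁ + c₂)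
  | iteTrue {b : Cond} {p₁ p₂ : Prog} {s s' : State} {t c : ℕ} :
      b.Holds s → Exec O p₁ s s' t c → Exec O (.ite b p₁ p₂) s s' (b.cost + t) c
  | iteFalse {b : Cond} {p₁ p₂ : Prog} {s s' : State} {t c : ℕ} :
      ¬ b.Holds s → Exec O p₂ s s' t c → Exec O (.ite b p₁ p₂) s s' (b.cost + t) c
  | whileTrue {b : Cond} {p : Prog} {s₁ s₂ s₃ : State} {t₁ t₂ c₁ c₂ : ℕ} :
      b.Holds s₁ → Exec O p s₁ s₂ t₁ c₁ → Exec O (.while b p) s₂ s₃ t₂ c₂ →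
      Exec O (.while b p) s₁ s₃ (b.cost + t₁ + t₂) (c₁ + c₂)
  | whileFalse {b : Cond} {p : Prog} {s : State} :
      ¬ b.Holds s → Exec O (.while b p) s s b.cost 0

/-! ## Input, oracle and output -/

/-- The evaluation oracle: the subcollection of the `j` with a nonzero flag in the array is
mapped to the measure of its union. -/
noncomputable def unionOracle {Ω : Type*} [MeasurableSpace Ω] (μ : Measure Ω) {n : ℕ}
    (Q : Fin n → Set Ω) (flags : ℕ → ℕ) : ℝ :=
  μ.real (⋃ (j : Fin n) (_ : flags j ≠ 0), Q j)

open Classical in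
/-- The input: the integers `n` and `m`, a list `A 0, …, A (m - 1)` of subcollections in the form
of its `m × n` incidence matrix (row by row), and the real number `Λ`. All other cells hold `0`. -/
noncomputable def inputState {n m : ℕ} (A : Fin m → Finset (Fin n)) (Λ : ℝ) : State where
  natVar i := if i = 0 then n else if i = 1 then m else 0
  natArr a i :=
    if a = 0 ∧ ∃ (k : Fin m) (j : Fin n), i = (k : ℕ) * n + (j : ℕ) ∧ j ∈ A k then 1 else 0
  realVar i := if i = 0 then Λ else 0
  realArr _ _ := 0

/-- The functions described by the output: entry `k * n + j` of the first real array is the value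
of the `j`-th function on the set `E_{A k}`, and the functions vanish off these sets. -/
noncomputable def outputFun {Ω : Type*} {n m : ℕ} (Q : Fin n → Set Ω)
    (A : Fin m → Finset (Fin n)) (s : State) (j : Fin n) (x : Ω) : ℝ :=
  ∑ k : Fin m, s.realArr 0 ((k : ℕ) * n + (j : ℕ)) * (atom Q (A k)).indicator 1 x

end CarlesonFlow

open CarlesonFlow

/-! The atoms `E_A` are disjoint, and the union of the sets `Q j`, `j ∈ J`, consists of the atoms
whose index set meets `J`. So the Carleson condition says that, for every `J`, the demands `μ (Q j)
/ Λ` with `j ∈ J` add up to at most the mass of the atoms that meet `J`. This is a Hall condition: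
the atoms can serve all demands at once, that is, some flow fills every edge into the sink. Such a
flow is maximal, and every other maximum flow then fills these edges too (`saturates_of_isMaxFlow`),
because the value can be read off at the sink. For a flow that fills them, the integral of `φ_j`
over `Q j` is the flow from `j` to the sink (`lintegral_phi`), and the sum of the `φ_j` is at most
`1` because at most `μ (E_A)` passes through `A` (`sum_phi_le_one`).

The filling flow comes from the algorithm itself: its total correctness (`runs_mainProg`) yields
both existence and the time bound. With `m + 1` oracle calls the masses of the atoms are found by
inclusion order (`runs_measureProg`). Then a push-relabel method runs on the reversed graph: each
set starts with its demand as excess, sends it to the atoms that it contains, and these send it to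
the sink.

By the Carleson condition a set of vertices without the sink that no residual arc leaves has no
excess (`Preflow.Valid.excess_eq_zero_of_closed`). Arcs not ending in the sink alternate between
sets and atoms, so a gap in the labels of either side produces such a closed set. Hence a vertex
with excess has label at most `2 * min n m + 2` (`Preflow.Valid.label_le`). Put `M = n + m` and `L =
2 * min n m + 3`. There are at most `M * L` relabels, each followed by at most one new scan of `M +
1` arcs, and at most `2 * M * L + 1` rounds with overhead `O(M)`. Since `(n + m) * min n m ≤ 2 * n *
m`, all this is `O(n²m + nm²)`. -/

namespace CarlesonFlow

section

/-! ## Total correctness with running times -/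

/-- Started in `s`, the program `p` halts, and the final state, the number of steps and the number
of oracle calls satisfy `R`. -/
def Runs (O : (ℕ → ℕ) → ℝ) (p : Prog) (s : State) (R : State → ℕ → ℕ → Prop) : Prop :=
  ∃ s' t c, Exec O p s s' t c ∧ R s' t c

/-- The variables of integers that a program may change. -/
def Prog.natVarMod : Prog → ℕ → Bool
  | .setNat i _, x => i == x
  | .seq p q, x => p.natVarMod x || q.natVarMod x
  | .ite _ p q, x => p.natVarMod x || q.natVarMod x
  | .while _ p, x => p.natVarMod x
  | _, _ => false

/-- The arrays of integers that a program may change. -/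
def Prog.natArrMod : Prog → ℕ → Bool
  | .writeNat a _ _, x => a == x
  | .seq p q, x => p.natArrMod x || q.natArrMod x
  | .ite _ p q, x => p.natArrMod x || q.natArrMod x
  | .while _ p, x => p.natArrMod x
  | _, _ => false

/-- The real variables that a program may change. -/
def Prog.realVarMod : Prog → ℕ → Bool
  | .setReal i _, x => i == x
  | .query i _, x => i == x
  | .seq p q, x => p.realVarMod x || q.realVarMod x
  | .ite _ p q, x => p.realVarMod x || q.realVarMod x
  | .while _ p, x => p.realVarMod x
  | _, _ => false

/-- The real arrays that a program may change. -/
def Prog.realArrMod : Prog → ℕ → Bool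
  | .writeReal a _ _, x => a == x
  | .seq p q, x => p.realArrMod x || q.realArrMod x
  | .ite _ p q, x => p.realArrMod x || q.realArrMod x
  | .while _ p, x => p.realArrMod x
  | _, _ => false

/-- The states `s` and `s'` agree on all variables and arrays that `p` does not assign. -/
structure Frame (p : Prog) (s s' : State) : Prop where
  nv : ∀ x, p.natVarMod x = false → s'.natVar x = s.natVar x
  na : ∀ x, p.natArrMod x = false → s'.natArr x = s.natArr x
  rv : ∀ x, p.realVarMod x = false → s'.realVar x = s.realVar x
  ra : ∀ x, p.realArrMod x = false → s'.realArr x = s.realArr x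

theorem Frame.refl (p : Prog) (s : State) : Frame p s s :=
  ⟨fun _ _ => rfl, fun _ _ => rfl, fun _ _ => rfl, fun _ _ => rfl⟩

theorem Frame.trans {p : Prog} {s₁ s₂ s₃ : State} (h₁ : Frame p s₁ s₂) (h₂ : Frame p s₂ s₃) :
    Frame p s₁ s₃ :=
  ⟨fun x h => (h₂.nv x h).trans (h₁.nv x h), fun x h => (h₂.na x h).trans (h₁.na x h),
    fun x h => (h₂.rv x h).trans (h₁.rv x h), fun x h => (h₂.ra x h).trans (h₁.ra x h)⟩

theorem Frame.weaken {p q : Prog} {s s' : State} (h : Frame p s s')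
    (hnv : ∀ x, q.natVarMod x = false → p.natVarMod x = false)
    (hna : ∀ x, q.natArrMod x = false → p.natArrMod x = false)
    (hrv : ∀ x, q.realVarMod x = false → p.realVarMod x = false)
    (hra : ∀ x, q.realArrMod x = false → p.realArrMod x = false) : Frame q s s' :=
  ⟨fun x hx => h.nv x (hnv x hx), fun x hx => h.na x (hna x hx),
    fun x hx => h.rv x (hrv x hx), fun x hx => h.ra x (hra x hx)⟩

theorem Frame.seq_left {p q : Prog} {s s' : State} (h : Frame p s s') : Frame (.seq p q) s s' := by
  apply h.weaken <;> intro x hx <;>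
    simp only [Prog.natVarMod, Prog.natArrMod, Prog.realVarMod, Prog.realArrMod,
      Bool.or_eq_false_iff] at hx <;> exact hx.1

theorem Frame.seq_right {p q : Prog} {s s' : State} (h : Frame q s s') :
    Frame (.seq p q) s s' := by
  apply h.weaken <;> intro x hx <;>
    simp only [Prog.natVarMod, Prog.natArrMod, Prog.realVarMod, Prog.realArrMod,
      Bool.or_eq_false_iff] at hx <;> exact hx.2

theorem Frame.ite_left {b : Cond} {p q : Prog} {s s' : State} (h : Frame p s s') :
    Frame (.ite b p q) s s' := by
  apply h.weaken <;> intro x hx <;>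
    simp only [Prog.natVarMod, Prog.natArrMod, Prog.realVarMod, Prog.realArrMod,
      Bool.or_eq_false_iff] at hx <;> exact hx.1

theorem Frame.ite_right {b : Cond} {p q : Prog} {s s' : State} (h : Frame q s s') :
    Frame (.ite b p q) s s' := by
  apply h.weaken <;> intro x hx <;>
    simp only [Prog.natVarMod, Prog.natArrMod, Prog.realVarMod, Prog.realArrMod,
      Bool.or_eq_false_iff] at hx <;> exact hx.2

/-- Thanks to this, a loop invariant only has to mention cells that the loop assigns. The side
conditions are Boolean computations on a concrete program and close by `rfl`. -/
theorem Exec.frame {O : (ℕ → ℕ) → ℝ} {p : Prog} {s s' : State} {t c : ℕ}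
    (h : Exec O p s s' t c) : Frame p s s' := by
  induction h with
  | skip s => exact Frame.refl _ _
  | setNat s i e =>
    refine ⟨fun x hx => ?_, fun _ _ => rfl, fun _ _ => rfl, fun _ _ => rfl⟩
    have : i ≠ x := by simpa [Prog.natVarMod] using hx
    simp [Function.update_of_ne this.symm]
  | writeNat s a idx e =>
    refine ⟨fun _ _ => rfl, fun x hx => ?_, fun _ _ => rfl, fun _ _ => rfl⟩
    have : a ≠ x := by simpa [Prog.natArrMod] using hx
    simp [Function.update_of_ne this.symm]
  | setReal s i e =>
    refine ⟨fun _ _ => rfl, fun _ _ => rfl, fun x hx => ?_, fun _ _ => rfl⟩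
    have : i ≠ x := by simpa [Prog.realVarMod] using hx
    simp [Function.update_of_ne this.symm]
  | writeReal s a idx e =>
    refine ⟨fun _ _ => rfl, fun _ _ => rfl, fun _ _ => rfl, fun x hx => ?_⟩
    have : a ≠ x := by simpa [Prog.realArrMod] using hx
    simp [Function.update_of_ne this.symm]
  | query s i a =>
    refine ⟨fun _ _ => rfl, fun _ _ => rfl, fun x hx => ?_, fun _ _ => rfl⟩
    have : i ≠ x := by simpa [Prog.realVarMod] using hx
    simp [Function.update_of_ne this.symm]
  | seq _ _ ih₁ ih₂ => exact ih₁.seq_left.trans ih₂.seq_right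
  | iteTrue _ _ ih => exact ih.ite_left
  | iteFalse _ _ ih => exact ih.ite_right
  | whileTrue _ _ _ ih₁ ih₂ =>
    exact Frame.trans ⟨ih₁.nv, ih₁.na, ih₁.rv, ih₁.ra⟩ ih₂
  | whileFalse _ => exact Frame.refl _ _

/-! ### Weakest preconditions and loop rules. -/

section Runs

variable {O : (ℕ → ℕ) → ℝ} {s : State} {R R' : State → ℕ → ℕ → Prop}

theorem Runs.mono {p : Prog} (h : Runs O p s R) (hR : ∀ s' t c, R s' t c → R' s' t c) :
    Runs O p s R' := by
  obtain ⟨s', t, c, he, hr⟩ := h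
  exact ⟨s', t, c, he, hR _ _ _ hr⟩

theorem Runs.frame {p : Prog} (h : Runs O p s R) :
    Runs O p s (fun s' t c => Frame p s s' ∧ R s' t c) := by
  obtain ⟨s', t, c, he, hr⟩ := h
  exact ⟨s', t, c, he, he.frame, hr⟩

/-- A consequence rule that also supplies the frame. -/
theorem Runs.conseq {p : Prog} (h : Runs O p s R)
    (hR : ∀ s' t c, Frame p s s' → R s' t c → R' s' t c) : Runs O p s R' :=
  h.frame.mono fun s' t c h' => hR s' t c h'.1 h'.2

/-- This and the following equivalences are weakest-precondition rules: rewriting with them turns a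
loop-free program into a statement about its explicit final state and cost. -/
theorem runs_skip : Runs O .skip s R ↔ R s 1 0 :=
  ⟨by rintro ⟨s', t, c, h, hr⟩; cases h; exact hr, fun h => ⟨_, _, _, .skip s, h⟩⟩

theorem runs_setNat {i : ℕ} {e : NatExpr} : Runs O (.setNat i e) s R ↔
    R { s with natVar := Function.update s.natVar i (e.eval s) } (e.cost + 1) 0 :=
  ⟨by rintro ⟨s', t, c, h, hr⟩; cases h; exact hr, fun h => ⟨_, _, _, .setNat s i e, h⟩⟩

theorem runs_setReal {i : ℕ} {e : RealExpr} : Runs O (.setReal i e) s R ↔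
    R { s with realVar := Function.update s.realVar i (e.eval s) } (e.cost + 1) 0 :=
  ⟨by rintro ⟨s', t, c, h, hr⟩; cases h; exact hr, fun h => ⟨_, _, _, .setReal s i e, h⟩⟩

theorem runs_writeNat {a : ℕ} {idx e : NatExpr} : Runs O (.writeNat a idx e) s R ↔
    R { s with natArr := Function.update s.natArr a
                  (Function.update (s.natArr a) (idx.eval s) (e.eval s)) }
      (idx.cost + e.cost + 1) 0 :=
  ⟨by rintro ⟨s', t, c, h, hr⟩; cases h; exact hr, fun h => ⟨_, _, _, .writeNat s a idx e, h⟩⟩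

theorem runs_writeReal {a : ℕ} {idx : NatExpr} {e : RealExpr} :
    Runs O (.writeReal a idx e) s R ↔
    R { s with realArr := Function.update s.realArr a
                  (Function.update (s.realArr a) (idx.eval s) (e.eval s)) }
      (idx.cost + e.cost + 1) 0 :=
  ⟨by rintro ⟨s', t, c, h, hr⟩; cases h; exact hr, fun h => ⟨_, _, _, .writeReal s a idx e, h⟩⟩

theorem runs_query {i a : ℕ} : Runs O (.query i a) s R ↔
    R { s with realVar := Function.update s.realVar i (O (s.natArr a)) } 1 1 :=
  ⟨by rintro ⟨s', t, c, h, hr⟩; cases h; exact hr, fun h => ⟨_, _, _, .query s i a, h⟩⟩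

theorem runs_seq {p q : Prog} : Runs O (.seq p q) s R ↔
    Runs O p s fun s₁ t₁ c₁ => Runs O q s₁ fun s₂ t₂ c₂ => R s₂ (t₁ + t₂) (c₁ + c₂) := by
  constructor
  · rintro ⟨s', t, c, h, hr⟩
    cases h with
    | seq h₁ h₂ => exact ⟨_, _, _, h₁, _, _, _, h₂, hr⟩
  · rintro ⟨_, _, _, h₁, _, _, _, h₂, hr⟩
    exact ⟨_, _, _, .seq h₁ h₂, hr⟩

theorem runs_ite {b : Cond} {p q : Prog} : Runs O (.ite b p q) s R ↔
    (b.Holds s → Runs O p s fun s' t c => R s' (b.cost + t) c) ∧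
    (¬ b.Holds s → Runs O q s fun s' t c => R s' (b.cost + t) c) := by
  constructor
  · rintro ⟨s', t, c, h, hr⟩
    cases h with
    | iteTrue hb h => exact ⟨fun _ => ⟨_, _, _, h, hr⟩, fun hn => absurd hb hn⟩
    | iteFalse hb h => exact ⟨fun hn => absurd hn hb, fun _ => ⟨_, _, _, h, hr⟩⟩
  · rintro ⟨h₁, h₂⟩
    by_cases hb : b.Holds s
    · obtain ⟨_, _, _, h, hr⟩ := h₁ hb
      exact ⟨_, _, _, .iteTrue hb h, hr⟩
    · obtain ⟨_, _, _, h, hr⟩ := h₂ hb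
      exact ⟨_, _, _, .iteFalse hb h, hr⟩

/-- The rule for `while`: each turn of the loop that takes time `t` must decrease the potential
`T` by at least `t` plus the time for the test. -/
theorem Runs.while_potential {b : Cond} {p : Prog} (I : State → Prop) (T : State → ℕ)
    (hstep : ∀ s', Frame (.while b p) s s' → I s' → b.Holds s' →
      Runs O p s' fun s'' t c => I s'' ∧ b.cost + t + T s'' ≤ T s' ∧ c = 0) (hs : I s) :
    Runs O (.while b p) s fun s' t c =>
      I s' ∧ ¬ b.Holds s' ∧ t + T s' ≤ T s + b.cost ∧ c = 0 := by
  -- The test has a positive price, so the potential drops strictly at each turn; induction on a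
  -- bound for it also gives termination.
  have hbc : 0 < b.cost := by cases b <;> simp [Cond.cost]
  suffices H : ∀ N s', Frame (.while b p) s s' → T s' ≤ N → I s' →
      Runs O (.while b p) s' fun s'' t c =>
        I s'' ∧ ¬ b.Holds s'' ∧ t + T s'' ≤ T s' + b.cost ∧ c = 0 from
    H _ s (Frame.refl _ _) le_rfl hs
  intro N
  induction N with
  | zero =>
    intro s' hf hT hI
    by_cases hb : b.Holds s'
    · obtain ⟨s'', t, c, he, h1, h2, h3⟩ := hstep s' hf hI hb
      omega
    · exact ⟨s', _, _, .whileFalse hb, hI, hb, by omega, rfl⟩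
  | succ N ih =>
    intro s' hf hT hI
    by_cases hb : b.Holds s'
    · obtain ⟨s₁, t, c, he, h1, h2, h3⟩ := hstep s' hf hI hb
      obtain ⟨s₂, t', c', he', h1', h2', h3', h4'⟩ := ih s₁
        (hf.trans ⟨he.frame.nv, he.frame.na, he.frame.rv, he.frame.ra⟩) (by omega) h1
      exact ⟨s₂, _, _, .whileTrue hb he he', h1', h2', by omega, by omega⟩
    · exact ⟨s', _, _, .whileFalse hb, hI, hb, by omega, rfl⟩

/-- `for i < b do body`. -/
def forLoop (i : ℕ) (b : NatExpr) (body : Prog) : Prog :=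
  .seq (.setNat i (.const 0))
    (.while (.natLt (.var i) b) (.seq body (.setNat i (.add (.var i) (.const 1)))))

/-- The rule for `for`: the invariant `I k s t c` speaks of the state before the turn `k` of the
loop, and of the steps and calls made so far by the body. -/
theorem Runs.forLoop {i : ℕ} {b : NatExpr} {body : Prog} (B : ℕ)
    (I : ℕ → State → ℕ → ℕ → Prop)
    (hi : body.natVarMod i = false)
    (hI : ∀ k s t c x, I k s t c → I k { s with natVar := Function.update s.natVar i x } t c)
    (hb : ∀ s', Frame (forLoop i b body) s s' → b.eval s' = B)
    (h0 : I 0 s 0 0)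
    (hstep : ∀ k s' t c, k < B → Frame (CarlesonFlow.forLoop i b body) s s' →
      s'.natVar i = k → I k s' t c →
      Runs O body s' fun s'' t' c' => I (k + 1) s'' (t + t') (c + c')) :
    Runs O (CarlesonFlow.forLoop i b body) s fun s' t c =>
      ∃ t', I B s' t' c ∧ t = t' + B * (b.cost + 6) + b.cost + 4 := by
  set F := CarlesonFlow.forLoop i b body with hF
  have hbody : ∀ {s s'}, Frame body s s' → Frame F s s' := fun h =>
    Frame.seq_right (h.weaken
      (fun x hx => by simp only [Prog.natVarMod, Bool.or_eq_false_iff] at hx; exact hx.1)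
      (fun x hx => by simp only [Prog.natArrMod, Bool.or_eq_false_iff] at hx; exact hx.1)
      (fun x hx => by simp only [Prog.realVarMod, Bool.or_eq_false_iff] at hx; exact hx.1)
      (fun x hx => by simp only [Prog.realArrMod, Bool.or_eq_false_iff] at hx; exact hx.1))
  have hupd : ∀ (s : State) x,
      Frame F s { s with natVar := Function.update s.natVar i x } := fun s x =>
    ⟨fun y hy => by
      have : i ≠ y := by
        rintro rfl
        simp [hF, CarlesonFlow.forLoop, Prog.natVarMod] at hy
      simp [Function.update_of_ne this.symm],
      fun _ _ => rfl, fun _ _ => rfl, fun _ _ => rfl⟩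
  -- Here `d` turns are left. Besides the body, a turn costs `b.cost + 2` for the test and `4` for
  -- the increment; the last, failing test costs `b.cost + 2`, and setting the counter to `0` adds
  -- `2` in the end.
  have key : ∀ d k s' t c, k + d = B → Frame F s s' → s'.natVar i = k → I k s' t c →
      Runs O (.while (.natLt (.var i) b) (.seq body (.setNat i (.add (.var i) (.const 1))))) s'
        fun s'' t'' c'' => ∃ t', I B s'' t' (c + c'') ∧
          t + t'' = t' + d * (b.cost + 6) + b.cost + 2 := by
    intro d
    induction d with
    | zero =>
      intro k s' t c hk hf hi' hI'
      obtain rfl : k = B := by omega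
      refine ⟨s', _, _, .whileFalse ?_, t, by simpa using hI', ?_⟩
      · simp [Cond.Holds, NatExpr.eval, hi', hb s' hf]
      · simp only [Cond.cost, NatExpr.cost]; omega
    | succ d ih =>
      intro k s' t c hk hf hi' hI'
      obtain ⟨s₂, t₂, c₂, he, hI₂⟩ := hstep k s' t c (by omega) hf hi' hI'
      have hi₂ : s₂.natVar i = k := (he.frame.nv i hi).trans hi'
      obtain ⟨s₃, t₃, c₃, he₃, t', hI₃, ht'⟩ :=
        ih (k + 1) { s₂ with natVar := Function.update s₂.natVar i (k + 1) } (t + t₂) (c + c₂)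
          (by omega) ((hf.trans (hbody he.frame)).trans (hupd _ _)) (by simp) (hI _ _ _ _ _ hI₂)
      have hset := Exec.setNat (O := O) s₂ i (.add (.var i) (.const 1))
      simp only [NatExpr.eval, hi₂] at hset
      refine ⟨s₃, _, _, .whileTrue ?_ (.seq he hset) he₃, t', ?_, ?_⟩
      · simp only [Cond.Holds, NatExpr.eval, hi', hb s' hf]; omega
      · convert hI₃ using 1; omega
      · simp only [Cond.cost, NatExpr.cost, Nat.succ_mul] at ht' ⊢; omega
  obtain ⟨s', t', c', he, t'', hI', ht'⟩ :=
    key B 0 { s with natVar := Function.update s.natVar i 0 } 0 0 (by omega) (hupd s 0)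
      (by simp) (hI _ _ _ _ _ h0)
  refine ⟨s', _, _, .seq (.setNat s i (.const 0)) he, t'', ?_, ?_⟩
  · convert hI' using 1
  · simp only [NatExpr.cost] at ht' ⊢; omega

end Runs

end

section

/-! ## Preflows and labels

The vertices are the numbers `0, …, M`, and `M` is the sink. -/

/-- Residual capacities, excesses, labels and current arcs. -/
structure Preflow where
  r : ℕ → ℕ → ℝ
  e : ℕ → ℝ
  h : ℕ → ℕ
  cur : ℕ → ℕ

/-- The hypotheses on the initial capacities and excesses: every arc that does not end in the sink
leads from `P` to its complement or back, and every set of vertices that does not contain the sink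
can send away all its excess. -/
structure PushProblem (M : ℕ) (r₀ : ℕ → ℕ → ℝ) (e₀ : ℕ → ℝ) : Prop where
  r_nonneg : ∀ v < M + 1, ∀ w < M + 1, 0 ≤ r₀ v w
  e_nonneg : ∀ v < M + 1, 0 ≤ e₀ v
  cut : ∀ S ⊆ Finset.range M,
    ∑ v ∈ S, e₀ v ≤ ∑ v ∈ S, ∑ w ∈ Finset.range (M + 1) \ S, r₀ v w

/-- Every arc that does not end in the sink leads from `P` to its complement or back. -/
def BipartiteArcs (M : ℕ) (r₀ : ℕ → ℕ → ℝ) (P : Finset ℕ) : Prop :=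
  ∀ v < M, ∀ w < M, r₀ v w ≠ 0 → (v ∈ P ↔ w ∉ P)

/-- The invariants of the push-relabel method. -/
structure Preflow.Valid (M L : ℕ) (r₀ : ℕ → ℕ → ℝ) (e₀ : ℕ → ℝ) (σ : Preflow) : Prop where
  r_nonneg : ∀ v < M + 1, ∀ w < M + 1, 0 ≤ σ.r v w
  e_nonneg : ∀ v < M + 1, 0 ≤ σ.e v
  r_add : ∀ v < M + 1, ∀ w < M + 1, σ.r v w + σ.r w v = r₀ v w + r₀ w v
  e_eq : ∀ v < M + 1, σ.e v = e₀ v + ∑ w ∈ Finset.range (M + 1), (σ.r v w - r₀ v w)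
  h_sink : σ.h M = 0
  label : ∀ v < M + 1, ∀ w < M + 1, 0 < σ.r v w → σ.h v ≤ σ.h w + 1
  not_admissible : ∀ v < M, ∀ w < σ.cur v, w < M + 1 → 0 < σ.r v w → σ.h v ≠ σ.h w + 1
  cur_le : ∀ v < M, σ.cur v ≤ M + 1
  h_le : ∀ v < M, σ.h v ≤ L

variable {M L : ℕ} {r₀ : ℕ → ℕ → ℝ} {e₀ : ℕ → ℝ} {σ σ' : Preflow} {v w : ℕ} {δ : ℝ}

/-! ### Closed sets and the bound on the labels. -/

/-- A set that residual arcs do not leave has no excess. -/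
theorem Preflow.Valid.excess_eq_zero_of_closed (hσ : σ.Valid M L r₀ e₀)
    (hp : PushProblem M r₀ e₀) {S : Finset ℕ} (hS : S ⊆ Finset.range M)
    (hcl : ∀ v ∈ S, ∀ w < M + 1, w ∉ S → σ.r v w = 0) (hv : v ∈ S) : σ.e v = 0 := by
  have hlt : ∀ v ∈ S, v < M + 1 := fun v hv => by
    have := Finset.mem_range.1 (hS hv); omega
  have hS' : S ⊆ Finset.range (M + 1) := fun v hv => Finset.mem_range.2 (hlt v hv)
  -- By `r_add` the change `r - r₀` is antisymmetric, so what is sent inside `S` cancels.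
  have hzero : ∑ v ∈ S, ∑ w ∈ S, (σ.r v w - r₀ v w) = 0 := by
    have h1 : ∑ v ∈ S, ∑ w ∈ S, (σ.r v w - r₀ v w)
        = - ∑ v ∈ S, ∑ w ∈ S, (σ.r v w - r₀ v w) := by
      conv_lhs => rw [Finset.sum_comm]
      rw [← Finset.sum_neg_distrib]
      refine Finset.sum_congr rfl fun v hv => ?_
      rw [← Finset.sum_neg_distrib]
      refine Finset.sum_congr rfl fun w hw => ?_
      linarith [hσ.r_add v (hlt v hv) w (hlt w hw)]
    linarith
  -- All arcs out of `S` have residual capacity `0`, so the excess of `S` has decreased by the full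
  -- initial capacity out of `S`, and by `cut` that is at least the initial excess.
  have hsum : ∑ v ∈ S, σ.e v ≤ 0 := by
    have h1 : ∀ v ∈ S, σ.e v = e₀ v + (∑ w ∈ S, (σ.r v w - r₀ v w)
        - ∑ w ∈ Finset.range (M + 1) \ S, r₀ v w) := by
      intro v hv
      rw [hσ.e_eq v (hlt v hv), ← Finset.sum_sdiff hS']
      have : ∑ w ∈ Finset.range (M + 1) \ S, (σ.r v w - r₀ v w)
          = - ∑ w ∈ Finset.range (M + 1) \ S, r₀ v w := by
        rw [← Finset.sum_neg_distrib]
        refine Finset.sum_congr rfl fun w hw => ?_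
        rw [Finset.mem_sdiff, Finset.mem_range] at hw
        rw [hcl v hv w hw.1 hw.2, zero_sub]
      rw [this]; ring
    rw [Finset.sum_congr rfl h1, Finset.sum_add_distrib, Finset.sum_sub_distrib, hzero]
    linarith [hp.cut S hS]
  have hnn : ∀ v ∈ S, 0 ≤ σ.e v := fun v hv => hσ.e_nonneg v (hlt v hv)
  exact le_antisymm ((Finset.single_le_sum hnn hv).trans hsum) (hnn v hv)

/-- A vertex with excess has a small label. -/
theorem Preflow.Valid.label_le (hσ : σ.Valid M L r₀ e₀) (hp : PushProblem M r₀ e₀)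
    {P : Finset ℕ} (hP : BipartiteArcs M r₀ P)
    (hv : v < M) (he : 0 < σ.e v) : σ.h v ≤ 2 * P.card + 2 := by
  classical
  by_contra! hlt
  -- Labels are grouped in pairs `2i + 1`, `2i + 2` (truncation puts `0` into the pair `i = 0`). If
  -- no vertex of `P` has its label in the pair `i`, the set `S` of vertices above the gap is
  -- closed: a residual arc goes down by at most one and changes sides, so it cannot cross the two
  -- missing levels. Then `v ∈ S` could have no excess. So `P` would occupy `P.card + 1` different
  -- pairs.
  have hlevel : ∀ i ∈ Finset.range (P.card + 1), ∃ w ∈ P, (σ.h w - 1) / 2 = i := by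
    intro i hi
    rw [Finset.mem_range] at hi
    by_contra! hno
    let S := (Finset.range M).filter fun w => 2 * i + 2 ≤ σ.h w ∧ (w ∈ P → 2 * i + 3 ≤ σ.h w)
    have hvS : v ∈ S := by
      simp only [S, Finset.mem_filter, Finset.mem_range]
      refine ⟨hv, by omega, fun _ => by omega⟩
    have := hσ.excess_eq_zero_of_closed hp (S := S) (Finset.filter_subset _ _) ?_ hvS
    · exact he.ne' this
    · intro u hu w hw hwS
      simp only [S, Finset.mem_filter, Finset.mem_range] at hu hwS
      obtain ⟨huM, hu2, hu3⟩ := hu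
      by_contra hr
      have hrpos : 0 < σ.r u w :=
        lt_of_le_of_ne (hσ.r_nonneg u (by omega) w hw) (Ne.symm hr)
      have hlab := hσ.label u (by omega) w hw hrpos
      rcases (by omega : w = M ∨ w < M) with rfl | hwM
      · have := hσ.h_sink
        omega
      -- A residual arc is an original arc or the reverse of one; either way it changes sides.
      have hside : u ∈ P ↔ w ∉ P := by
        have hadd := hσ.r_add u (by omega) w hw
        by_cases h1 : r₀ u w = 0
        · have h2 : r₀ w u ≠ 0 := by
            intro h2
            have := hσ.r_nonneg w hw u (by omega)
            linarith
          have := hP w hwM u huM h2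
          tauto
        · exact hP u huM w hwM h1
      have hnw := hno w
      apply hwS
      by_cases hwP : w ∈ P
      · have := hnw hwP
        refine ⟨hwM, by omega, fun _ => by omega⟩
      · have := hu3 (hside.2 hwP)
        exact ⟨hwM, by omega, fun h => absurd h hwP⟩
  have hsub : Finset.range (P.card + 1) ⊆ P.image fun w => (σ.h w - 1) / 2 := by
    intro i hi
    obtain ⟨w, hw, rfl⟩ := hlevel i hi
    exact Finset.mem_image_of_mem _ hw
  have := (Finset.card_le_card hsub).trans Finset.card_image_le
  simp at this

/-! ### Pushing, advancing and relabelling preserve the invariants. -/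

/-- `σ'` is obtained from `σ` by sending `δ` along the arc from `v` to `w`. -/
structure Preflow.IsPush (M : ℕ) (σ σ' : Preflow) (v w : ℕ) (δ : ℝ) : Prop where
  r_fwd : σ'.r v w = σ.r v w - δ
  r_bwd : σ'.r w v = σ.r w v + δ
  r_other : ∀ a < M + 1, ∀ b < M + 1, ¬ (a = v ∧ b = w) → ¬ (a = w ∧ b = v) → σ'.r a b = σ.r a b
  e_src : σ'.e v = σ.e v - δ
  e_dst : σ'.e w = σ.e w + δ
  e_other : ∀ a, a ≠ v → a ≠ w → σ'.e a = σ.e a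
  h_eq : σ'.h = σ.h
  cur_eq : σ'.cur = σ.cur

/-- The only arc that can become residual is the one from `w` to `v`. It leads one level up, so it
violates no label condition and is not admissible, and the current arcs stay correct. -/
theorem Preflow.Valid.push (hσ : σ.Valid M L r₀ e₀) (hpush : σ.IsPush M σ' v w δ)
    (hv : v < M + 1) (hw : w < M + 1) (hδ : 0 ≤ δ) (hδe : δ ≤ σ.e v) (hδr : δ ≤ σ.r v w)
    (hadm : σ.h v = σ.h w + 1) : σ'.Valid M L r₀ e₀ := by
  have hvw : v ≠ w := by rintro rfl; omega
  have hr : ∀ a < M + 1, ∀ b < M + 1, (a = v ∧ b = w) ∨ (a = w ∧ b = v) ∨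
      (σ'.r a b = σ.r a b ∧ σ'.r b a = σ.r b a ∧ ¬ (a = v ∧ b = w) ∧ ¬ (a = w ∧ b = v)) := by
    intro a ha b hb
    by_cases h1 : a = v ∧ b = w
    · exact .inl h1
    by_cases h2 : a = w ∧ b = v
    · exact .inr (.inl h2)
    exact .inr (.inr ⟨hpush.r_other a ha b hb h1 h2, hpush.r_other b hb a ha (by tauto) (by tauto),
      h1, h2⟩)
  have hpos : ∀ a < M + 1, ∀ b < M + 1, 0 < σ'.r a b → 0 < σ.r a b ∨ (a = w ∧ b = v) := by
    intro a ha b hb h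
    rcases hr a ha b hb with ⟨rfl, rfl⟩ | h1 | ⟨h1, -⟩
    · left; linarith [hpush.r_fwd]
    · exact .inr h1
    · left; rwa [← h1]
  refine ⟨?_, ?_, ?_, ?_, ?_, ?_, ?_, ?_, ?_⟩
  · intro a ha b hb
    have := hσ.r_nonneg a ha b hb
    rcases hr a ha b hb with ⟨rfl, rfl⟩ | ⟨rfl, rfl⟩ | ⟨h1, -⟩
    · linarith [hpush.r_fwd]
    · linarith [hpush.r_bwd]
    · rwa [h1]
  · intro a ha
    have := hσ.e_nonneg a ha
    by_cases h1 : a = v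
    · subst h1; linarith [hpush.e_src]
    by_cases h2 : a = w
    · subst h2; linarith [hpush.e_dst]
    rwa [hpush.e_other a h1 h2]
  · intro a ha b hb
    have := hσ.r_add a ha b hb
    rcases hr a ha b hb with ⟨rfl, rfl⟩ | ⟨rfl, rfl⟩ | ⟨h1, h2, -⟩
    · linarith [hpush.r_fwd, hpush.r_bwd]
    · linarith [hpush.r_fwd, hpush.r_bwd]
    · rw [h1, h2, this]
  · intro a ha
    have hold := hσ.e_eq a ha
    have hsplit : ∀ x, x < M + 1 → (∀ b < M + 1, b ≠ x → σ'.r a b = σ.r a b) →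
        ∑ b ∈ Finset.range (M + 1), (σ'.r a b - r₀ a b)
          = (σ'.r a x - σ.r a x) + ∑ b ∈ Finset.range (M + 1), (σ.r a b - r₀ a b) := by
      intro x hx hb
      rw [← sub_eq_iff_eq_add, ← Finset.sum_sub_distrib,
        Finset.sum_eq_single_of_mem x (Finset.mem_range.2 hx)]
      · ring
      · intro b hb1 hb2
        rw [hb b (Finset.mem_range.1 hb1) hb2]; ring
    by_cases h1 : a = v
    · subst h1
      rw [hsplit w hw fun b hb hbw => hpush.r_other a ha b hb (by tauto) (by tauto),
        hpush.r_fwd, hpush.e_src, hold]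
      ring
    by_cases h2 : a = w
    · subst h2
      rw [hsplit v hv fun b hb hbw => hpush.r_other a ha b hb (by tauto) (by tauto),
        hpush.r_bwd, hpush.e_dst, hold]
      ring
    rw [hpush.e_other a h1 h2, hold, hsplit a ha fun b hb hbw =>
      hpush.r_other a ha b hb (by tauto) (by tauto),
      hpush.r_other a ha a ha (by tauto) (by tauto)]
    ring
  · rw [hpush.h_eq]; exact hσ.h_sink
  · intro a ha b hb h
    rw [hpush.h_eq]
    rcases hpos a ha b hb h with h | ⟨rfl, rfl⟩
    · exact hσ.label a ha b hb h
    · omega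
  · intro a ha b hb hbM h
    rw [hpush.h_eq]
    rw [hpush.cur_eq] at hb
    rcases hpos a (by omega) b hbM h with h | ⟨rfl, rfl⟩
    · exact hσ.not_admissible a ha b hb hbM h
    · omega
  · rw [hpush.cur_eq]; exact hσ.cur_le
  · rw [hpush.h_eq]; exact hσ.h_le

/-- Moving on to the next arc. -/
def Preflow.advance (σ : Preflow) (v : ℕ) : Preflow :=
  { σ with cur := Function.update σ.cur v (σ.cur v + 1) }

/-- Raising the label. -/
def Preflow.relabel (σ : Preflow) (v : ℕ) : Preflow :=
  { σ with h := Function.update σ.h v (σ.h v + 1), cur := Function.update σ.cur v 0 }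

theorem Preflow.Valid.advance (hσ : σ.Valid M L r₀ e₀) (hcur : σ.cur v < M + 1)
    (hadm : 0 < σ.r v (σ.cur v) → σ.h v ≠ σ.h (σ.cur v) + 1) :
    (σ.advance v).Valid M L r₀ e₀ := by
  refine ⟨hσ.r_nonneg, hσ.e_nonneg, hσ.r_add, hσ.e_eq, hσ.h_sink, hσ.label, ?_, ?_, hσ.h_le⟩
  · intro a ha b hb hbM h
    simp only [Preflow.advance] at hb h ⊢
    by_cases hav : a = v
    · subst hav
      rw [Function.update_self] at hb
      rcases (by omega : b < σ.cur a ∨ b = σ.cur a) with h1 | rfl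
      · exact hσ.not_admissible a ha b h1 hbM h
      · exact hadm h
    · rw [Function.update_of_ne hav] at hb
      exact hσ.not_admissible a ha b hb hbM h
  · intro a ha
    simp only [Preflow.advance]
    by_cases hav : a = v
    · subst hav; rw [Function.update_self]; omega
    · rw [Function.update_of_ne hav]; exact hσ.cur_le a ha

/-- All arcs of `v` have been passed over, so a residual arc from `v` to `w` has `h v ≤ h w`, which
leaves room to raise `h v` by one. A residual arc from `a` to `v` had `h a ≤ h v + 1`, so after the
raise it is not admissible, and no other current arc has to be reset. -/
theorem Preflow.Valid.relabel (hσ : σ.Valid M L r₀ e₀) (hv : v < M) (hcur : σ.cur v = M + 1)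
    (hL : σ.h v + 1 ≤ L) : (σ.relabel v).Valid M L r₀ e₀ := by
  refine ⟨hσ.r_nonneg, hσ.e_nonneg, hσ.r_add, hσ.e_eq, ?_, ?_, ?_, ?_, ?_⟩
  · simp only [Preflow.relabel]
    rw [Function.update_of_ne hv.ne']; exact hσ.h_sink
  · intro a ha b hb h
    simp only [Preflow.relabel] at h ⊢
    have h1 := hσ.label a ha b hb h
    by_cases hav : a = v <;> by_cases hbv : b = v
    · subst hav; subst hbv; omega
    · subst hav
      rw [Function.update_self, Function.update_of_ne hbv]
      have := hσ.not_admissible a hv b (by omega) hb h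
      omega
    · subst hbv
      rw [Function.update_self, Function.update_of_ne hav]; omega
    · rw [Function.update_of_ne hav, Function.update_of_ne hbv]; omega
  · intro a ha b hb hbM h
    simp only [Preflow.relabel] at hb h ⊢
    have h1 := hσ.label a (by omega) b hbM h
    by_cases hav : a = v
    · subst hav; rw [Function.update_self] at hb; omega
    · rw [Function.update_of_ne hav] at hb ⊢
      have := hσ.not_admissible a ha b hb hbM h
      by_cases hbv : b = v
      · subst hbv; rw [Function.update_self]; omega
      · rw [Function.update_of_ne hbv]; exact this
  · intro a ha
    simp only [Preflow.relabel]
    by_cases hav : a = v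
    · subst hav; rw [Function.update_self]; omega
    · rw [Function.update_of_ne hav]; exact hσ.cur_le a ha
  · intro a ha
    simp only [Preflow.relabel]
    by_cases hav : a = v
    · subst hav; rw [Function.update_self]; omega
    · rw [Function.update_of_ne hav]; exact hσ.h_le a ha

/-! ### Potentials for the running time. -/

/-- The potential that pays for scanning arcs. -/
def Preflow.scanPotential (M L : ℕ) (σ : Preflow) : ℕ :=
  ∑ v ∈ Finset.range M, ((L - σ.h v) * (M + 2) + (M + 1 - σ.cur v))

theorem sum_lt_of_lt_of_eq {f g : ℕ → ℕ} (hv : v < M) (hlt : f v + 1 ≤ g v)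
    (heq : ∀ a, a ≠ v → f a = g a) :
    ∑ a ∈ Finset.range M, f a + 1 ≤ ∑ a ∈ Finset.range M, g a := by
  refine Nat.succ_le_of_lt (Finset.sum_lt_sum (fun a _ => ?_) ⟨v, Finset.mem_range.2 hv, hlt⟩)
  by_cases h : a = v
  · subst h; omega
  · exact (heq a h).le

theorem Preflow.scanPotential_advance (hv : v < M) (hcur : σ.cur v < M + 1) :
    (σ.advance v).scanPotential M L + 1 ≤ σ.scanPotential M L := by
  refine sum_lt_of_lt_of_eq hv ?_ fun a ha => ?_
  · simp only [Preflow.advance, Function.update_self]; omega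
  · simp only [Preflow.advance, Function.update_of_ne ha]

/-- The raise releases `M + 2`, and resetting the current arc takes back at most `M + 1`. -/
theorem Preflow.scanPotential_relabel (hv : v < M) (hL : σ.h v + 1 ≤ L) :
    (σ.relabel v).scanPotential M L + 1 ≤ σ.scanPotential M L := by
  refine sum_lt_of_lt_of_eq hv ?_ fun a ha => ?_
  · simp only [Preflow.relabel, Function.update_self]
    obtain ⟨d, hd⟩ : ∃ d, L = σ.h v + 1 + d := ⟨L - (σ.h v + 1), by omega⟩
    have h1 : L - (σ.h v + 1) = d := by omega
    have h2 : L - σ.h v = d + 1 := by omega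
    rw [h1, h2, Nat.succ_mul]; omega
  · simp only [Preflow.relabel, Function.update_of_ne ha]

open Classical in
/-- One more than the largest label of a vertex with excess, or `0`. -/
noncomputable def Preflow.top (M : ℕ) (σ : Preflow) : ℕ :=
  (Finset.range M).sup fun v => if 0 < σ.e v then σ.h v + 1 else 0

theorem Preflow.top_le_iff {k : ℕ} :
    σ.top M ≤ k ↔ ∀ v < M, 0 < σ.e v → σ.h v + 1 ≤ k := by
  classical
  simp only [Preflow.top, Finset.sup_le_iff, Finset.mem_range]
  refine forall₂_congr fun v _ => ?_
  by_cases h : 0 < σ.e v <;> simp [h]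

/-- The potential that decreases with each round. -/
noncomputable def Preflow.roundPotential (M L : ℕ) (σ : Preflow) : ℕ :=
  2 * ∑ v ∈ Finset.range M, (L - σ.h v) + σ.top M

/-- The state of a round that started in `σ₀`, when the vertices below `k` have been treated. -/
structure Preflow.RoundInv (M L : ℕ) (σ₀ : Preflow) (k : ℕ) (σ : Preflow) : Prop where
  treated : ∀ v < M, 0 < σ.e v → σ.h v ≤ σ₀.top M
  untreated : ∀ v < M, k ≤ v → 0 < σ.e v → σ.h v + 1 ≤ σ₀.top M
  progress : (σ.h = σ₀.h ∧ ∀ v < k, v < M → 0 < σ.e v → σ.h v + 2 ≤ σ₀.top M) ∨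
    ∑ v ∈ Finset.range M, (L - σ.h v) + 1 ≤ ∑ v ∈ Finset.range M, (L - σ₀.h v)

theorem Preflow.RoundInv.start (σ₀ : Preflow) : Preflow.RoundInv M L σ₀ 0 σ₀ := by
  have := (Preflow.top_le_iff (M := M) (σ := σ₀)).1 le_rfl
  exact ⟨fun v hv he => by have := this v hv he; omega, fun v hv _ he => this v hv he,
    .inl ⟨rfl, fun v hv => by omega⟩⟩

/-- If no label has changed, all excess now sits strictly below the old top level, and the top
falls. Otherwise the sum of the `L - h v`, which counts twice, falls by at least one, while the top
rises by at most one because raised labels are still at most `σ₀.top M`. -/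
theorem Preflow.RoundInv.finish {σ₀ : Preflow} (h : Preflow.RoundInv M L σ₀ M σ)
    (hact : ∃ v < M, 0 < σ₀.e v) :
    σ.roundPotential M L + 1 ≤ σ₀.roundPotential M L := by
  have htop := (Preflow.top_le_iff (M := M) (σ := σ₀)).1 le_rfl
  obtain ⟨u, hu, hue⟩ := hact
  have hpos := htop u hu hue
  simp only [Preflow.roundPotential]
  rcases h.progress with ⟨heq, hlt⟩ | hlt
  · have : σ.top M ≤ σ₀.top M - 1 := Preflow.top_le_iff.2 fun v hv he => by
      have := hlt v hv hv he; omega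
    rw [heq]; omega
  · have : σ.top M ≤ σ₀.top M + 1 := Preflow.top_le_iff.2 fun v hv he => by
      have := h.treated v hv he; omega
    omega

/-- The treatment of `k`, before a possible change of its label: all pushes go to lower labels. -/
structure Preflow.Discharging (M : ℕ) (σ σ' : Preflow) (k : ℕ) : Prop where
  h_eq : σ'.h = σ.h
  active : ∀ v < M, 0 < σ'.e v → 0 < σ.e v ∨ (0 < σ.e k ∧ σ.h v + 1 ≤ σ.h k)

theorem Preflow.Discharging.refl (σ : Preflow) (k : ℕ) : Preflow.Discharging M σ σ k :=
  ⟨rfl, fun _ _ h => .inl h⟩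

theorem Preflow.Discharging.push {σ'' : Preflow} {k : ℕ} (h : Preflow.Discharging M σ σ' k)
    (hk : k < M) (hpush : σ'.IsPush M σ'' k w δ) (he : 0 < σ'.e k)
    (hadm : σ'.h k = σ'.h w + 1) : Preflow.Discharging M σ σ'' k := by
  have hek : 0 < σ.e k := by
    rcases h.active k hk he with h | ⟨h, -⟩ <;> exact h
  refine ⟨hpush.h_eq.trans h.h_eq, fun v hv hv' => ?_⟩
  by_cases h1 : v = k
  · subst h1; exact .inl hek
  by_cases h2 : v = w
  · subst h2
    rw [h.h_eq] at hadm
    exact .inr ⟨hek, hadm.ge⟩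
  rw [hpush.e_other v h1 h2] at hv'
  exact h.active v hv hv'

/-- A vertex that receives excess from `k` has a label below that of `k`, hence at most `σ₀.top M -
2`. This satisfies every bound of the invariant, whether its turn in the round is over or not. -/
theorem Preflow.RoundInv.discharge {σ₀ : Preflow} {k : ℕ} (h : Preflow.RoundInv M L σ₀ k σ)
    (hk : k < M) (hd : Preflow.Discharging M σ σ' k) (he : ¬ 0 < σ'.e k) :
    Preflow.RoundInv M L σ₀ (k + 1) σ' := by
  have hk0 := h.untreated k hk le_rfl
  refine ⟨fun v hv hv' => ?_, fun v hv hkv hv' => ?_, ?_⟩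
  · rw [hd.h_eq]
    rcases hd.active v hv hv' with h1 | ⟨h1, h2⟩
    · exact h.treated v hv h1
    · have := hk0 h1; omega
  · rw [hd.h_eq]
    rcases hd.active v hv hv' with h1 | ⟨h1, h2⟩
    · exact h.untreated v hv (by omega) h1
    · have := hk0 h1; omega
  · rw [hd.h_eq]
    refine h.progress.imp_left fun h2 => ⟨h2.1, fun v hvk hv hv' => ?_⟩
    rcases hd.active v hv hv' with h1 | ⟨h1, h3⟩
    · rcases (by omega : v < k ∨ v = k) with h4 | rfl
      · exact h2.2 v h4 hv h1
      · exact absurd hv' he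
    · have := hk0 h1; omega

/-- Before its turn `k` has label at most `σ₀.top M - 1`, and a turn raises it only once, which is
what `treated` allows. -/
theorem Preflow.RoundInv.discharge_relabel {σ₀ : Preflow} {k : ℕ}
    (h : Preflow.RoundInv M L σ₀ k σ)
    (hk : k < M) (hd : Preflow.Discharging M σ σ' k) (he : 0 < σ'.e k) (hL : σ'.h k + 1 ≤ L) :
    Preflow.RoundInv M L σ₀ (k + 1) (σ'.relabel k) := by
  have hek : 0 < σ.e k := by
    rcases hd.active k hk he with h | ⟨h, -⟩ <;> exact h
  have hk0 := h.untreated k hk le_rfl hek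
  rw [hd.h_eq] at hL
  refine ⟨fun v hv hv' => ?_, fun v hv hkv hv' => ?_, .inr ?_⟩
  · simp only [Preflow.relabel, hd.h_eq] at hv' ⊢
    by_cases hvk : v = k
    · subst hvk; rw [Function.update_self]; exact hk0
    rw [Function.update_of_ne hvk]
    rcases hd.active v hv hv' with h1 | ⟨h1, h2⟩
    · exact h.treated v hv h1
    · omega
  · simp only [Preflow.relabel, hd.h_eq] at hv' ⊢
    rw [Function.update_of_ne (by omega)]
    rcases hd.active v hv hv' with h1 | ⟨h1, h2⟩
    · exact h.untreated v hv (by omega) h1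
    · omega
  · have h1 : ∑ v ∈ Finset.range M, (L - (σ'.relabel k).h v) + 1
        ≤ ∑ v ∈ Finset.range M, (L - σ.h v) := by
      refine sum_lt_of_lt_of_eq hk ?_ fun a ha => ?_
      · simp only [Preflow.relabel, Function.update_self, hd.h_eq]; omega
      · simp only [Preflow.relabel, Function.update_of_ne ha, hd.h_eq]
    rcases h.progress with ⟨h2, -⟩ | h2
    · rw [h2] at h1; exact h1
    · omega

/-- The potentials of the initial state. -/
theorem Preflow.roundPotential_initial (σ : Preflow) (hσ : σ.h = fun _ => 0) :
    σ.roundPotential M L ≤ 2 * (M * L) + 1 := by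
  have : σ.top M ≤ 1 := Preflow.top_le_iff.2 fun v _ _ => by simp [hσ]
  simp only [Preflow.roundPotential, hσ]
  simpa using this

theorem Preflow.scanPotential_initial (σ : Preflow) (hσ : σ.h = fun _ => 0)
    (hσ' : σ.cur = fun _ => 0) :
    σ.scanPotential M L = M * (L * (M + 2) + (M + 1)) := by
  simp [Preflow.scanPotential, hσ, hσ']

/-- The total excess does not change. -/
theorem Preflow.Valid.sum_e (hσ : σ.Valid M L r₀ e₀) :
    ∑ v ∈ Finset.range (M + 1), σ.e v = ∑ v ∈ Finset.range (M + 1), e₀ v := by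
  have h1 : ∑ v ∈ Finset.range (M + 1), ∑ w ∈ Finset.range (M + 1), (σ.r v w - r₀ v w)
      = - ∑ v ∈ Finset.range (M + 1), ∑ w ∈ Finset.range (M + 1), (σ.r v w - r₀ v w) := by
    conv_lhs => rw [Finset.sum_comm]
    rw [← Finset.sum_neg_distrib]
    refine Finset.sum_congr rfl fun v hv => ?_
    rw [← Finset.sum_neg_distrib]
    refine Finset.sum_congr rfl fun w hw => ?_
    linarith [hσ.r_add v (Finset.mem_range.1 hv) w (Finset.mem_range.1 hw)]
  rw [Finset.sum_congr rfl fun v hv => hσ.e_eq v (Finset.mem_range.1 hv),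
    Finset.sum_add_distrib]
  linarith

end

section

/-! ## The push-relabel program

Variables: `2` holds `M`, `3` holds `M + 1`, `8` and `9` hold the ends of an arc. Integer arrays:
`2` holds the row offsets, `5` the labels, `6` the current arcs. Real arrays: `1` holds the residual
capacities, `2` the excesses. -/

/-- The preflow in the memory. -/
def State.preflow (M : ℕ) (s : State) : Preflow where
  r v w := s.realArr 1 (v * (M + 1) + w)
  e := s.realArr 2
  h := s.natArr 5
  cur := s.natArr 6

/-- The constants used by the push-relabel program are in place. -/
structure State.HasOffsets (M : ℕ) (s : State) : Prop where
  sink : s.natVar 2 = M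
  size : s.natVar 3 = M + 1
  offset : ∀ v < M + 1, s.natArr 2 v = v * (M + 1)

theorem State.HasOffsets.of_frame {M : ℕ} {p : Prog} {s s' : State} (h : s.HasOffsets M)
    (hf : Frame p s s') (h2 : p.natVarMod 2 = false) (h3 : p.natVarMod 3 = false)
    (ha : p.natArrMod 2 = false) : s'.HasOffsets M :=
  ⟨(hf.nv 2 h2).trans h.sink, (hf.nv 3 h3).trans h.size, by rw [hf.na 2 ha]; exact h.offset⟩

/-- The address of the arc between the vertices in two variables. -/
def arcAddr (i j : ℕ) : NatExpr := .add (.read 2 (.var i)) (.var j)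

/-- Send as much as possible from the vertex `8` to the vertex `9`. -/
def pushProg : Prog :=
  .seq (.ite (.realLt (.read 2 (.var 8)) (.read 1 (arcAddr 8 9)))
      (.setReal 3 (.read 2 (.var 8))) (.setReal 3 (.read 1 (arcAddr 8 9))))
  (.seq (.writeReal 1 (arcAddr 8 9) (.sub (.read 1 (arcAddr 8 9)) (.var 3)))
  (.seq (.writeReal 1 (arcAddr 9 8) (.add (.read 1 (arcAddr 9 8)) (.var 3)))
  (.seq (.writeReal 2 (.var 8) (.sub (.read 2 (.var 8)) (.var 3)))
    (.writeReal 2 (.var 9) (.add (.read 2 (.var 9)) (.var 3))))))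

theorem addr_inj {N a b c d : ℕ} (hb : b < N) (hd : d < N) (h : a * N + b = c * N + d) :
    a = c ∧ b = d := by
  have hN : 0 < N := by omega
  have h1 : (a * N + b) / N = a := by
    rw [mul_comm, Nat.mul_add_div hN, Nat.div_eq_of_lt hb, add_zero]
  have h2 : (c * N + d) / N = c := by
    rw [mul_comm, Nat.mul_add_div hN, Nat.div_eq_of_lt hd, add_zero]
  have h3 : a = c := by rw [← h1, ← h2, h]
  subst h3
  exact ⟨rfl, by omega⟩

variable {O : (ℕ → ℕ) → ℝ} {M L : ℕ} {r₀ : ℕ → ℕ → ℝ} {e₀ : ℕ → ℝ}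

theorem runs_pushProg {s : State} {v w : ℕ} (hs : s.HasOffsets M) (h8 : s.natVar 8 = v)
    (h9 : s.natVar 9 = w) (hv : v < M + 1) (hw : w < M + 1) (hvw : v ≠ w) :
    Runs O pushProg s fun s' t c => t ≤ 50 ∧ c = 0 ∧
      (s.preflow M).IsPush M (s'.preflow M) v w
        (min ((s.preflow M).e v) ((s.preflow M).r v w)) := by
  have hne : v * (M + 1) + w ≠ w * (M + 1) + v := fun h => hvw (addr_inj hw hv h).1
  have hne' := hne.symm
  have hwv := hvw.symm
  -- Both branches of the test store their half of the minimum in the real variable `3`; the four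
  -- updates are verified once, for any stored `δ`.
  have key : ∀ δ : ℝ, ∀ s : State, s.HasOffsets M → s.natVar 8 = v → s.natVar 9 = w →
      s.realVar 3 = δ →
      Runs O (.seq (.writeReal 1 (arcAddr 8 9) (.sub (.read 1 (arcAddr 8 9)) (.var 3)))
        (.seq (.writeReal 1 (arcAddr 9 8) (.add (.read 1 (arcAddr 9 8)) (.var 3)))
        (.seq (.writeReal 2 (.var 8) (.sub (.read 2 (.var 8)) (.var 3)))
          (.writeReal 2 (.var 9) (.add (.read 2 (.var 9)) (.var 3)))))) s
        fun s' t c => t ≤ 36 ∧ c = 0 ∧ (s.preflow M).IsPush M (s'.preflow M) v w δ := by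
    intro δ s hs h8 h9 h3
    simp only [runs_seq, runs_writeReal, arcAddr, NatExpr.eval, RealExpr.eval, NatExpr.cost,
      RealExpr.cost, h8, h9, h3, hs.offset v hv, hs.offset w hw]
    refine ⟨by norm_num, trivial, ?_⟩
    constructor
    · simp [State.preflow, hne]
    · simp [State.preflow, hne']
    · intro a ha b hb h1 h2
      have g1 : a * (M + 1) + b ≠ v * (M + 1) + w := fun h => h1 (addr_inj hb hw h)
      have g2 : a * (M + 1) + b ≠ w * (M + 1) + v := fun h => h2 (addr_inj hb hv h)
      simp [State.preflow, g1, g2]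
    · simp [State.preflow, hvw]
    · simp [State.preflow, hwv]
    · intro a h1 h2
      simp [State.preflow, h1, h2]
    · rfl
    · rfl
  rw [pushProg, runs_seq, runs_ite]
  simp only [runs_setReal, Cond.Holds, arcAddr, RealExpr.eval, NatExpr.eval, h8, h9,
    hs.offset v hv]
  refine ⟨fun hlt => ?_, fun hlt => ?_⟩
  · refine (key _ { s with realVar := Function.update s.realVar 3 (s.realArr 2 v) }
      ⟨hs.sink, hs.size, hs.offset⟩ h8 h9 rfl).mono ?_
    rintro s' t c ⟨h1, h2, h3⟩
    refine ⟨?_, by omega, ?_⟩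
    · simp only [Cond.cost, RealExpr.cost, NatExpr.cost]; omega
    · rw [min_eq_left (show (s.preflow M).e v ≤ (s.preflow M).r v w from hlt.le)]; exact h3
  · refine (key _ { s with realVar := Function.update s.realVar 3 (s.realArr 1 (v * (M + 1) + w)) }
      ⟨hs.sink, hs.size, hs.offset⟩ h8 h9 rfl).mono ?_
    rintro s' t c ⟨h1, h2, h3⟩
    refine ⟨?_, by omega, ?_⟩
    · simp only [Cond.cost, RealExpr.cost, NatExpr.cost]; omega
    · rw [min_eq_right (show (s.preflow M).r v w ≤ (s.preflow M).e v from not_lt.1 hlt)]; exact h3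

/-- Treat the current arc of the vertex `8`. -/
def scanProg : Prog :=
  .seq (.setNat 9 (.read 6 (.var 8)))
  (.seq (.ite (.and (.realLt (.const 0) (.read 1 (arcAddr 8 9)))
        (.natEq (.read 5 (.var 8)) (.add (.read 5 (.var 9)) (.const 1))))
      pushProg .skip)
    (.ite (.realLt (.const 0) (.read 2 (.var 8)))
      (.writeNat 6 (.var 8) (.add (.read 6 (.var 8)) (.const 1))) .skip))

open Classical in
/-- The potential of the loop over the current arcs of `v`. -/
noncomputable def Preflow.arcPotential (M L v : ℕ) (σ : Preflow) : ℕ :=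
  100 * σ.scanPotential M L + if 0 < σ.e v then 100 else 0

theorem Preflow.scanPotential_push {σ σ' : Preflow} {v w : ℕ} {δ : ℝ}
    (h : σ.IsPush M σ' v w δ) : σ'.scanPotential M L = σ.scanPotential M L := by
  simp only [Preflow.scanPotential, h.h_eq, h.cur_eq]

/-- If excess is left after the push, the push has used up the residual capacity, so the arc may be
passed over and the scan potential falls. If none is left, the current arc stays, and the turn is
paid by the extra `100` that `arcPotential` grants an active vertex. The gap between `85` and `100`
covers the test of the surrounding loop. -/
theorem runs_scanProg {s : State} {v : ℕ} {σ₁ : Preflow} (hs : s.HasOffsets M)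
    (h8 : s.natVar 8 = v)
    (hv : v < M) (hval : (s.preflow M).Valid M L r₀ e₀) (he : 0 < (s.preflow M).e v)
    (hcur : (s.preflow M).cur v < M + 1) (hd : Preflow.Discharging M σ₁ (s.preflow M) v) :
    Runs O scanProg s fun s' t c => t ≤ 85 ∧ c = 0 ∧ (s'.preflow M).Valid M L r₀ e₀ ∧
      Preflow.Discharging M σ₁ (s'.preflow M) v ∧
      (s'.preflow M).arcPotential M L v + 100 ≤ (s.preflow M).arcPotential M L v := by
  set w := s.natArr 6 v with hw
  have hcur' : w < M + 1 := hcur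
  have hfin : ∀ (s₁ : State) t₁, s₁.natVar 8 = v → t₁ ≤ 75 →
      (s₁.preflow M).Valid M L r₀ e₀ → Preflow.Discharging M σ₁ (s₁.preflow M) v →
      (s₁.preflow M).cur v = w → (s₁.preflow M).scanPotential M L = (s.preflow M).scanPotential M L →
      (0 < (s₁.preflow M).e v → 0 < (s₁.preflow M).r v w →
        (s₁.preflow M).h v ≠ (s₁.preflow M).h w + 1) →
      Runs O (.ite (.realLt (.const 0) (.read 2 (.var 8)))
        (.writeNat 6 (.var 8) (.add (.read 6 (.var 8)) (.const 1))) .skip) s₁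
        fun s' t c => t₁ + t ≤ 85 ∧ c = 0 ∧ (s'.preflow M).Valid M L r₀ e₀ ∧
          Preflow.Discharging M σ₁ (s'.preflow M) v ∧
          (s'.preflow M).arcPotential M L v + 100 ≤ (s.preflow M).arcPotential M L v := by
    intro s₁ t₁ g8 ht gval gd gcur gpot gadm
    rw [runs_ite]
    simp only [runs_writeNat, runs_skip, Cond.Holds, RealExpr.eval, NatExpr.eval, g8,
      Cond.cost, NatExpr.cost, RealExpr.cost, Rat.cast_zero]
    refine ⟨fun hlt => ⟨by omega, trivial, ?_⟩, fun hlt => ⟨by omega, trivial, gval, gd, ?_⟩⟩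
    · have hadv := gval.advance (v := v) (by rw [gcur]; exact hcur') (by rw [gcur]; exact gadm hlt)
      have hpot := Preflow.scanPotential_advance (L := L) hv
        (show (s₁.preflow M).cur v < M + 1 by rw [gcur]; exact hcur')
      refine ⟨hadv, ⟨gd.h_eq, gd.active⟩, ?_⟩
      change ((s₁.preflow M).advance v).arcPotential M L v + 100 ≤ _
      simp only [Preflow.arcPotential]
      rw [if_pos he, if_pos (show 0 < ((s₁.preflow M).advance v).e v from hlt)]
      omega
    · have : ¬ 0 < (s₁.preflow M).e v := hlt
      simp only [Preflow.arcPotential]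
      rw [if_pos he, if_neg this]
      omega
  rw [scanProg, runs_seq, runs_setNat, runs_seq, runs_ite]
  simp only [NatExpr.eval, h8, ← hw]
  set s₁ : State := { s with natVar := Function.update s.natVar 9 w } with hs₁
  have g8 : s₁.natVar 8 = v := h8
  have g9 : s₁.natVar 9 = w := rfl
  have gs : s₁.HasOffsets M := ⟨hs.sink, hs.size, hs.offset⟩
  simp only [Cond.Holds, RealExpr.eval, NatExpr.eval, g8, g9, gs.offset v (by omega), arcAddr,
    Rat.cast_zero, runs_skip]
  refine ⟨fun hadm => ?_, fun hadm => ?_⟩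
  · have hadm1 : 0 < (s.preflow M).r v w := hadm.1
    have hadm2 : (s.preflow M).h v = (s.preflow M).h w + 1 := hadm.2
    have hvw : v ≠ w := by intro h; rw [← h] at hadm2; omega
    refine (runs_pushProg gs g8 g9 (by omega) hcur' hvw).conseq ?_
    rintro s₂ t c hf ⟨ht, rfl, hpush⟩
    have hpush : (s.preflow M).IsPush M (s₂.preflow M) v w
        (min ((s.preflow M).e v) ((s.preflow M).r v w)) := hpush
    refine (hfin s₂ (t + 21) ((hf.nv 8 rfl).trans g8) (by omega)
      (hval.push hpush (by omega) hcur' (le_min he.le hadm1.le) (min_le_left _ _)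
        (min_le_right _ _) hadm2)
      (hd.push hv hpush he hadm2) (by rw [hpush.cur_eq]; rfl)
      (Preflow.scanPotential_push hpush) ?_).mono ?_
    · intro h1 h2
      exfalso
      rw [hpush.e_src] at h1
      rw [hpush.r_fwd] at h2
      rcases min_choice ((s.preflow M).e v) ((s.preflow M).r v w) with h | h <;> rw [h] at h1 h2 <;>
        linarith
    · rintro s' t' c' ⟨h1, h2, h3⟩
      refine ⟨?_, by omega, h3⟩
      simp only [Cond.cost, NatExpr.cost, RealExpr.cost] at h1 ⊢; omega
  · refine (hfin s₁ 21 g8 (by omega) hval hd rfl rfl ?_).mono ?_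
    · intro _ h1 h2; exact hadm ⟨h1, h2⟩
    · rintro s' t' c' ⟨h1, h2, h3⟩
      refine ⟨?_, by omega, h3⟩
      simp only [Cond.cost, NatExpr.cost, RealExpr.cost] at h1 ⊢; omega

/-- Send away the excess of the vertex `8` along its current arcs; if some is left when all arcs
are used up, then raise the label. -/
def dischargeProg : Prog :=
  .seq (.while (.and (.realLt (.const 0) (.read 2 (.var 8))) (.natLt (.read 6 (.var 8)) (.var 3)))
      scanProg)
    (.ite (.realLt (.const 0) (.read 2 (.var 8)))
      (.seq (.writeNat 5 (.var 8) (.add (.read 5 (.var 8)) (.const 1)))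
        (.writeNat 6 (.var 8) (.const 0)))
      .skip)

/-- Only the turn that exhausts the excess is not paid by the scan potential, and there is at most
one. The constant `150` covers it, the final tests and the relabel. -/
theorem runs_dischargeProg
    (hlab : ∀ σ : Preflow, σ.Valid M L r₀ e₀ → ∀ v < M, 0 < σ.e v → σ.h v + 1 ≤ L)
    {s : State} {v : ℕ} {σ₀ : Preflow} (hs : s.HasOffsets M)
    (h8 : s.natVar 8 = v) (hv : v < M) (hval : (s.preflow M).Valid M L r₀ e₀)
    (hround : Preflow.RoundInv M L σ₀ v (s.preflow M)) :
    Runs O dischargeProg s fun s' t c => c = 0 ∧ (s'.preflow M).Valid M L r₀ e₀ ∧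
      Preflow.RoundInv M L σ₀ (v + 1) (s'.preflow M) ∧
      t + 100 * (s'.preflow M).scanPotential M L
        ≤ 150 + 100 * (s.preflow M).scanPotential M L := by
  rw [dischargeProg, runs_seq]
  refine (Runs.while_potential
    (fun s' => (s'.preflow M).Valid M L r₀ e₀ ∧
      Preflow.Discharging M (s.preflow M) (s'.preflow M) v)
    (fun s' => (s'.preflow M).arcPotential M L v) ?_ ⟨hval, Preflow.Discharging.refl _ _⟩).conseq ?_
  · rintro s' hf ⟨h1, h2⟩ hb
    have g8 : s'.natVar 8 = v := (hf.nv 8 rfl).trans h8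
    have gs : s'.HasOffsets M := hs.of_frame hf rfl rfl rfl
    simp only [Cond.Holds, RealExpr.eval, NatExpr.eval, g8, gs.size, Rat.cast_zero] at hb
    refine (runs_scanProg gs g8 hv h1 hb.1 hb.2 h2).mono ?_
    rintro s'' t c ⟨ht, hc, h3, h4, h5⟩
    refine ⟨⟨h3, h4⟩, ?_, hc⟩
    simp only [Cond.cost, NatExpr.cost, RealExpr.cost]
    omega
  · rintro s₁ t₁ c₁ hf ⟨⟨h1, h2⟩, hb, ht, rfl⟩
    have g8 : s₁.natVar 8 = v := (hf.nv 8 rfl).trans h8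
    have gs : s₁.HasOffsets M := hs.of_frame hf rfl rfl rfl
    simp only [Cond.Holds, RealExpr.eval, NatExpr.eval, g8, gs.size, Rat.cast_zero] at hb
    have hpot : (s.preflow M).arcPotential M L v ≤ 100 * (s.preflow M).scanPotential M L + 100 := by
      simp only [Preflow.arcPotential]; split_ifs <;> omega
    have hpot' : 100 * (s₁.preflow M).scanPotential M L ≤ (s₁.preflow M).arcPotential M L v := by
      simp only [Preflow.arcPotential]; omega
    rw [runs_ite]
    simp only [runs_seq, runs_writeNat, runs_skip, Cond.Holds, RealExpr.eval, NatExpr.eval, g8,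
      Cond.cost, NatExpr.cost, RealExpr.cost, Rat.cast_zero] at ht ⊢
    refine ⟨fun he => ?_, fun he => ?_⟩
    -- The loop has stopped although excess is left, so the arcs are used up.
    · have hcur : (s₁.preflow M).cur v = M + 1 :=
        le_antisymm (h1.cur_le v hv) (not_lt.1 fun h => hb ⟨he, h⟩)
      have hL := hlab _ h1 v hv he
      have hpr := Preflow.scanPotential_relabel (σ := s₁.preflow M) hv hL
      have hst : ({ s₁ with
          natArr := Function.update (Function.update s₁.natArr 5
            (Function.update (s₁.natArr 5) v (s₁.natArr 5 v + 1))) 6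
              (Function.update (Function.update s₁.natArr 5
                (Function.update (s₁.natArr 5) v (s₁.natArr 5 v + 1)) 6) v 0) } : State).preflow M
          = (s₁.preflow M).relabel v := rfl
      refine ⟨trivial, ?_⟩
      rw [hst]
      exact ⟨h1.relabel hv hcur hL, hround.discharge_relabel hv h2 he hL, by omega⟩
    · exact ⟨trivial, h1, hround.discharge hv h2 he, by omega⟩

/-- Discharge all vertices in turn until all excess has reached the sink. -/
def pushRelabelProg : Prog :=
  .while (.realLt (.read 2 (.var 2)) (.var 4)) (forLoop 8 (.var 2) dischargeProg)

/-- The total excess never changes and is kept in the real variable `4`, so one comparison with the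
excess of the sink detects whether another vertex is active. A round costs `150` per vertex plus `7`
for loop control, paid by `roundPotential`; the scans are paid by `scanPotential`. -/
theorem runs_pushRelabelProg (hp : PushProblem M r₀ e₀)
    (hlab : ∀ σ : Preflow, σ.Valid M L r₀ e₀ → ∀ v < M, 0 < σ.e v → σ.h v + 1 ≤ L)
    {s : State} (hs : s.HasOffsets M)
    (hr : ∀ v < M + 1, ∀ w < M + 1, (s.preflow M).r v w = r₀ v w)
    (he : ∀ v < M + 1, (s.preflow M).e v = e₀ v)
    (hh : (s.preflow M).h = fun _ => 0) (hcur : (s.preflow M).cur = fun _ => 0)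
    (hD : s.realVar 4 = ∑ v ∈ Finset.range (M + 1), e₀ v) :
    Runs O pushRelabelProg s fun s' t c => c = 0 ∧ (s'.preflow M).Valid M L r₀ e₀ ∧
      (∀ v < M, (s'.preflow M).e v = 0) ∧
      t ≤ (2 * (M * L) + 1) * (157 * M + 20) + 100 * (M * (L * (M + 2) + (M + 1))) + 20 := by
  have hval : (s.preflow M).Valid M L r₀ e₀ := by
    refine ⟨fun v hv w hw => ?_, fun v hv => ?_, fun v hv w hw => ?_, fun v hv => ?_, ?_, ?_, ?_,
      ?_, ?_⟩
    · rw [hr v hv w hw]; exact hp.r_nonneg v hv w hw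
    · rw [he v hv]; exact hp.e_nonneg v hv
    · rw [hr v hv w hw, hr w hw v hv]
    · rw [he v hv, Finset.sum_eq_zero, add_zero]
      intro w hw
      rw [hr v hv w (Finset.mem_range.1 hw), sub_self]
    · rw [hh]
    · intro v _ w _ _; simp [hh]
    · intro v _ w hw; simp [hcur] at hw
    · intro v _; simp [hcur]
    · intro v _; simp [hh]
  have hDsum : ∀ s' : State, (s'.preflow M).Valid M L r₀ e₀ → s.realVar 4 =
      ∑ v ∈ Finset.range M, (s'.preflow M).e v + (s'.preflow M).e M := fun s' h => by
    rw [hD, ← h.sum_e, Finset.sum_range_succ]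
  rw [pushRelabelProg]
  refine (Runs.while_potential (fun s' => (s'.preflow M).Valid M L r₀ e₀)
    (fun s' => (s'.preflow M).roundPotential M L * (157 * M + 20)
      + 100 * (s'.preflow M).scanPotential M L) ?_ hval).conseq ?_
  · intro s₁ hf hval₁ hb
    have gs : s₁.HasOffsets M := hs.of_frame hf rfl rfl rfl
    have g4 : s₁.realVar 4 = s.realVar 4 := hf.rv 4 rfl
    simp only [Cond.Holds, RealExpr.eval, NatExpr.eval, gs.sink, g4] at hb
    have hact : ∃ v < M, 0 < (s₁.preflow M).e v := by
      by_contra! h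
      have := hDsum s₁ hval₁
      have h2 : ∑ v ∈ Finset.range M, (s₁.preflow M).e v ≤ 0 :=
        Finset.sum_nonpos fun v hv => h v (Finset.mem_range.1 hv)
      have h3 : (s₁.preflow M).e M = s₁.realArr 2 M := rfl
      linarith
    refine (Runs.forLoop M (fun k s' t c => c = 0 ∧ (s'.preflow M).Valid M L r₀ e₀ ∧
      Preflow.RoundInv M L (s₁.preflow M) k (s'.preflow M) ∧
      t + 100 * (s'.preflow M).scanPotential M L
        ≤ 150 * k + 100 * (s₁.preflow M).scanPotential M L) rfl ?_ ?_ ?_ ?_).mono ?_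
    · intro k s t c x h; exact h
    · intro s' hf'
      exact (gs.of_frame hf' rfl rfl rfl).sink
    · exact ⟨rfl, hval₁, Preflow.RoundInv.start _, by omega⟩
    · rintro k s' t c hk hf' h8 ⟨rfl, h1, h2, h3⟩
      refine (runs_dischargeProg hlab (gs.of_frame hf' rfl rfl rfl) h8 hk h1 h2).mono ?_
      rintro s'' t' c' ⟨rfl, h4, h5, h6⟩
      exact ⟨rfl, h4, h5, by omega⟩
    · rintro s' t c ⟨t', ⟨rfl, h1, h2, h3⟩, rfl⟩
      refine ⟨h1, ?_, rfl⟩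
      have h4 := h2.finish hact
      have h5 := Nat.mul_le_mul_right (157 * M + 20) h4
      rw [Nat.succ_mul] at h5
      simp only [Cond.cost, NatExpr.cost, RealExpr.cost]
      omega
  · rintro s' t c hf ⟨hval', hb, ht, rfl⟩
    have gs : s'.HasOffsets M := hs.of_frame hf rfl rfl rfl
    have g4 : s'.realVar 4 = s.realVar 4 := hf.rv 4 rfl
    simp only [Cond.Holds, RealExpr.eval, NatExpr.eval, gs.sink, g4, not_lt] at hb
    refine ⟨rfl, hval', ?_, ?_⟩
    · have h1 := hDsum s' hval'
      have h3 : (s'.preflow M).e M = s'.realArr 2 M := rfl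
      have hnn : ∀ v ∈ Finset.range M, 0 ≤ (s'.preflow M).e v := fun v hv =>
        hval'.e_nonneg v (by have := Finset.mem_range.1 hv; omega)
      have h2 : ∑ v ∈ Finset.range M, (s'.preflow M).e v = 0 :=
        le_antisymm (by linarith) (Finset.sum_nonneg hnn)
      intro v hv
      exact (Finset.sum_eq_zero_iff_of_nonneg hnn).1 h2 v (Finset.mem_range.2 hv)
    · have h1 := Preflow.roundPotential_initial (M := M) (L := L) (s.preflow M) hh
      have h2 := Preflow.scanPotential_initial (M := M) (L := L) (s.preflow M) hh hcur
      have h3 := Nat.mul_le_mul_right (157 * M + 20) h1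
      rw [h2] at ht
      simp only [Cond.cost, NatExpr.cost, RealExpr.cost] at ht
      omega

end

section

/-! ## Row offsets -/

/-- Fill the integer array `a` with the multiples of the variable `w`, up to the multiple `b`. -/
def offsetProg (a b w : ℕ) : Prog :=
  forLoop 4 (.var b) (.writeNat a (.add (.var 4) (.const 1)) (.add (.read a (.var 4)) (.var w)))

variable {O : (ℕ → ℕ) → ℝ}

/-- The machine does not multiply integers. The row offsets are tabulated by repeated addition, so
that each later matrix access takes constant time. -/
theorem runs_offsetProg {a b w B W : ℕ} {s : State} (hb : s.natVar b = B) (hw : s.natVar w = W)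
    (hb4 : b ≠ 4) (hw4 : w ≠ 4) (ha : s.natArr a 0 = 0) :
    Runs O (offsetProg a b w) s fun s' t c =>
      c = 0 ∧ t = 15 * B + 5 ∧ ∀ k ≤ B, s'.natArr a k = k * W := by
  have hmod : ∀ x, x ≠ 4 → (offsetProg a b w).natVarMod x = false := by
    intro x hx
    simp [offsetProg, forLoop, Prog.natVarMod, hx.symm]
  refine (Runs.forLoop B (fun k s t c => c = 0 ∧ t = 8 * k ∧ ∀ i ≤ k, s.natArr a i = i * W)
    rfl ?_ ?_ ?_ ?_).mono ?_
  · intro k s t c x h; exact h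
  · intro s' hf
    exact (hf.nv b (hmod b hb4)).trans hb
  · refine ⟨rfl, rfl, fun i hi => ?_⟩
    obtain rfl : i = 0 := by omega
    simpa using ha
  · rintro k s' t c hk hf h4 ⟨rfl, rfl, h⟩
    have gw : s'.natVar w = W := (hf.nv w (hmod w hw4)).trans hw
    simp only [runs_writeNat, NatExpr.eval, NatExpr.cost, h4, gw]
    refine ⟨trivial, by omega, fun i hi => ?_⟩
    simp only [Function.update_self]
    by_cases hik : i = k + 1
    · subst hik
      rw [Function.update_self, h k le_rfl]; ring
    · rw [Function.update_of_ne hik, h i (by omega)]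
  · rintro s' t c ⟨t', ⟨rfl, rfl, h⟩, rfl⟩
    refine ⟨rfl, ?_, h⟩
    simp only [NatExpr.cost]; omega

/-- The sizes `M` and `M + 1` and the row offsets. -/
def setupProg : Prog :=
  .seq (.setNat 2 (.add (.var 0) (.var 1)))
  (.seq (.setNat 3 (.add (.var 2) (.const 1)))
  (.seq (offsetProg 1 1 0) (offsetProg 2 3 3)))

/-- The memory holds the incidence matrix of the sets `A k`, `k < m`, of numbers below `n`, and the
row offsets. -/
structure State.HasInput (n m : ℕ) (A : ℕ → Finset ℕ) (s : State) : Prop where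
  nv0 : s.natVar 0 = n
  nv1 : s.natVar 1 = m
  inc : ∀ k < m, ∀ j < n, s.natArr 0 (k * n + j) = if j ∈ A k then 1 else 0
  row : ∀ k < m, s.natArr 1 k = k * n
  offsets : s.HasOffsets (n + m)

variable {n m : ℕ} {A : ℕ → Finset ℕ}

theorem State.HasInput.of_frame {p : Prog} {s s' : State} (h : s.HasInput n m A)
    (hf : Frame p s s') (h0 : p.natVarMod 0 = false) (h1 : p.natVarMod 1 = false)
    (h2 : p.natVarMod 2 = false) (h3 : p.natVarMod 3 = false) (ha0 : p.natArrMod 0 = false)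
    (ha1 : p.natArrMod 1 = false) (ha2 : p.natArrMod 2 = false) : s'.HasInput n m A :=
  ⟨(hf.nv 0 h0).trans h.nv0, (hf.nv 1 h1).trans h.nv1, by rw [hf.na 0 ha0]; exact h.inc,
    by rw [hf.na 1 ha1]; exact h.row, h.offsets.of_frame hf h2 h3 ha2⟩

theorem runs_setupProg {s : State} (h0 : s.natVar 0 = n) (h1 : s.natVar 1 = m)
    (hinc : ∀ k < m, ∀ j < n, s.natArr 0 (k * n + j) = if j ∈ A k then 1 else 0)
    (ha1 : s.natArr 1 0 = 0) (ha2 : s.natArr 2 0 = 0) :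
    Runs O setupProg s fun s' t c => c = 0 ∧ t ≤ 32 * (n + m) + 60 ∧ s'.HasInput n m A := by
  rw [setupProg, runs_seq, runs_setNat, runs_seq, runs_setNat, runs_seq]
  simp only [NatExpr.eval, NatExpr.cost]
  refine (runs_offsetProg (B := m) (W := n) (by simpa using h1) (by simpa using h0) (by norm_num)
    (by norm_num) (by exact ha1)).conseq ?_
  rintro s₁ t₁ c₁ hf₁ ⟨rfl, rfl, h⟩
  have g3 : s₁.natVar 3 = n + m + 1 := by
    rw [hf₁.nv 3 rfl]; simp [h0, h1]
  refine (runs_offsetProg (B := n + m + 1) (W := n + m + 1) g3 g3 (by norm_num) (by norm_num)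
    ?_).conseq ?_
  · rw [hf₁.na 2 rfl]; exact ha2
  rintro s₂ t₂ c₂ hf₂ ⟨rfl, rfl, h'⟩
  refine ⟨rfl, by omega, ⟨?_, ?_, ?_, ?_, ⟨?_, ?_, ?_⟩⟩⟩
  · rw [hf₂.nv 0 rfl, hf₁.nv 0 rfl]; exact h0
  · rw [hf₂.nv 1 rfl, hf₁.nv 1 rfl]; exact h1
  · rw [hf₂.na 0 rfl, hf₁.na 0 rfl]; exact hinc
  · rw [hf₂.na 1 rfl]; exact fun k hk => h k hk.le
  · rw [hf₂.nv 2 rfl, hf₁.nv 2 rfl]; simp [h0, h1]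
  · rw [hf₂.nv 3 rfl, g3]
  · exact fun v hv => h' v hv.le

/-! ## The measures of the atoms -/

/-- The address of an entry of a matrix with `n` columns. -/
def incAddr (i j : ℕ) : NatExpr := .add (.read 1 (.var i)) (.var j)

/-- The cardinalities of the sets `A k`. -/
def sizeProg : Prog :=
  forLoop 4 (.var 1) (forLoop 5 (.var 0)
    (.writeNat 3 (.var 4) (.add (.read 3 (.var 4)) (.read 0 (incAddr 4 5)))))

theorem card_filter_range_succ (p : ℕ → Prop) [DecidablePred p] (k : ℕ) :
    ((Finset.range (k + 1)).filter p).card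
      = ((Finset.range k).filter p).card + if p k then 1 else 0 := by
  rw [Finset.range_add_one, Finset.filter_insert]
  split_ifs with h
  · rw [Finset.card_insert_of_notMem (by simp)]
  · rfl

theorem sum_filter_range_succ (p : ℕ → Prop) [DecidablePred p] (f : ℕ → ℝ) (k : ℕ) :
    ∑ i ∈ (Finset.range (k + 1)).filter p, f i
      = ∑ i ∈ (Finset.range k).filter p, f i + if p k then f k else 0 := by
  rw [Finset.sum_filter, Finset.sum_range_succ, ← Finset.sum_filter]

theorem filter_range_mem_of_subset {S : Finset ℕ} (h : S ⊆ Finset.range n) :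
    (Finset.range n).filter (· ∈ S) = S := by
  ext j
  simp only [Finset.mem_filter]
  exact ⟨fun h => h.2, fun hj => ⟨h hj, hj⟩⟩

theorem runs_sizeProg {s : State} (hs : s.HasInput n m A)
    (hA : ∀ k < m, A k ⊆ Finset.range n) (h3 : s.natArr 3 = fun _ => 0) :
    Runs O sizeProg s fun s' t c => c = 0 ∧ t ≤ 22 * (m * n) + 12 * m + 5 ∧
      ∀ k < m, s'.natArr 3 k = (A k).card := by
  refine (Runs.forLoop m (fun k s' t c => c = 0 ∧ t ≤ 22 * (k * n) + 5 * k ∧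
      (∀ i < k, s'.natArr 3 i = (A i).card) ∧ ∀ i, k ≤ i → s'.natArr 3 i = 0)
    rfl ?_ ?_ ?_ ?_).mono ?_
  · intro k s t c x h; exact h
  · intro s' hf
    exact (hf.nv 1 rfl).trans hs.nv1
  · exact ⟨rfl, by simp, by simp, by simp [h3]⟩
  · rintro k s₁ t₁ c₁ hk hf₁ h4 ⟨rfl, ht, h5, h6⟩
    have gs₁ : s₁.HasInput n m A := hs.of_frame hf₁ rfl rfl rfl rfl rfl rfl rfl
    refine (Runs.forLoop n (fun j s' t c => c = 0 ∧ t ≤ 15 * j ∧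
      s'.natArr 3 k = ((Finset.range j).filter (· ∈ A k)).card ∧
      ∀ i, i ≠ k → s'.natArr 3 i = s₁.natArr 3 i) rfl ?_ ?_ ?_ ?_).mono ?_
    · intro k s t c x h; exact h
    · intro s' hf
      exact (hf.nv 0 rfl).trans gs₁.nv0
    · exact ⟨rfl, by simp, by simp [h6 k le_rfl], fun _ _ => rfl⟩
    · rintro j s₂ t₂ c₂ hj hf₂ g5 ⟨rfl, ht₂, h7, h8⟩
      have gs₂ : s₂.HasInput n m A := gs₁.of_frame hf₂ rfl rfl rfl rfl rfl rfl rfl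
      have g4 : s₂.natVar 4 = k := (hf₂.nv 4 rfl).trans h4
      simp only [runs_writeNat, NatExpr.eval, NatExpr.cost, incAddr, g4, g5, gs₂.row k hk,
        gs₂.inc k hk j hj, Function.update_self]
      refine ⟨trivial, by omega, ?_, fun i hi => ?_⟩
      · rw [h7, card_filter_range_succ]
      · rw [Function.update_of_ne hi, h8 i hi]
    · rintro s₂ t₂ c₂ ⟨t', ⟨rfl, ht', h7, h8⟩, rfl⟩
      refine ⟨rfl, ?_, fun i hi => ?_, fun i hi => ?_⟩
      · simp only [NatExpr.cost, Nat.succ_mul]; omega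
      · rcases (by omega : i < k ∨ i = k) with hik | rfl
        · rw [h8 i hik.ne, h5 i hik]
        · rw [h7, filter_range_mem_of_subset (hA i hk)]
      · rw [h8 i (by omega), h6 i (by omega)]
  · rintro s₂ t₂ c₂ ⟨t', ⟨rfl, ht', h7, h8⟩, rfl⟩
    refine ⟨rfl, ?_, h7⟩
    simp only [NatExpr.cost]; omega

/-- Count in the variable `7` the elements of the set number `6` that are not in the set
number `4`. -/
def diffProg : Prog :=
  .seq (.setNat 7 (.const 0)) (forLoop 5 (.var 0)
    (.setNat 7 (.add (.var 7) (.sub (.read 0 (incAddr 6 5)) (.read 0 (incAddr 4 5))))))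

/-- The truncated difference of the two incidence bits is `1` exactly for an element of `A l`
outside `A k`, so the count vanishes exactly for `A l ⊆ A k`. -/
theorem runs_diffProg {s : State} {k l : ℕ} (hs : s.HasInput n m A)
    (hA : ∀ k < m, A k ⊆ Finset.range n) (h4 : s.natVar 4 = k) (h6 : s.natVar 6 = l)
    (hk : k < m) (hl : l < m) :
    Runs O diffProg s fun s' t c => c = 0 ∧ t ≤ 22 * n + 7 ∧ (s'.natVar 7 = 0 ↔ A l ⊆ A k) := by
  rw [diffProg, runs_seq, runs_setNat]
  refine (Runs.forLoop n (fun j s' t c => c = 0 ∧ t ≤ 15 * j ∧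
    (s'.natVar 7 = 0 ↔ ∀ i < j, i ∈ A l → i ∈ A k)) rfl ?_ ?_ ?_ ?_).mono ?_
  · intro k s t c x h; exact h
  · intro s' hf
    exact (hf.nv 0 rfl).trans hs.nv0
  · exact ⟨rfl, by simp, by simp [NatExpr.eval]⟩
  · rintro j s₂ t₂ c₂ hj hf₂ g5 ⟨rfl, ht₂, h7⟩
    have gs₁ : State.HasInput n m A
        { s with natVar := Function.update s.natVar 7 (NatExpr.eval s (.const 0)) } :=
      ⟨hs.nv0, hs.nv1, hs.inc, hs.row, ⟨hs.offsets.sink, hs.offsets.size, hs.offsets.offset⟩⟩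
    have gs₂ : s₂.HasInput n m A := gs₁.of_frame hf₂ rfl rfl rfl rfl rfl rfl rfl
    have g4 : s₂.natVar 4 = k := (hf₂.nv 4 rfl).trans h4
    have g6 : s₂.natVar 6 = l := (hf₂.nv 6 rfl).trans h6
    simp only [runs_setNat, NatExpr.eval, NatExpr.cost, incAddr, g4, g5, g6, gs₂.row k hk,
      gs₂.row l hl, gs₂.inc k hk j hj, gs₂.inc l hl j hj, Function.update_self]
    refine ⟨trivial, by omega, ?_⟩
    rw [Nat.forall_lt_succ_right, ← h7, Nat.add_eq_zero_iff, and_congr_right_iff]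
    intro _
    by_cases h1 : j ∈ A l <;> by_cases h2 : j ∈ A k <;> simp [h1, h2]
  · rintro s₂ t₂ c₂ ⟨t', ⟨rfl, ht', h7⟩, rfl⟩
    refine ⟨rfl, ?_, ?_⟩
    · simp only [NatExpr.cost]; omega
    · rw [h7]
      exact ⟨fun h i hi => h i (Finset.mem_range.1 (hA l hl hi)) hi, fun h i _ hi => h hi⟩

/-- The measure of the atom number `4`, when the atoms with smaller sets are known. -/
def atomProg : Prog :=
  .seq (forLoop 5 (.var 0)
    (.writeNat 4 (.var 5) (.sub (.const 1) (.read 0 (incAddr 4 5)))))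
  (.seq (.query 2 4)
  (.seq (.setReal 2 (.sub (.var 1) (.var 2)))
  (.seq (forLoop 6 (.var 1) (.seq diffProg
      (.ite (.natEq (.var 7) (.const 0)) (.setReal 2 (.sub (.var 2) (.read 3 (.var 6)))) .skip)))
    (.writeReal 3 (.var 4) (.var 2)))))

/-- `O` returns for each set of numbers the sum of the weights `c k` of the sets `A k` that meet
it. -/
def IsUnionOracle (m : ℕ) (A : ℕ → Finset ℕ) (c : ℕ → ℝ) (O : (ℕ → ℕ) → ℝ) : Prop :=
  ∀ flags, O flags = ∑ l ∈ (Finset.range m).filter (fun l => ∃ j ∈ A l, flags j ≠ 0), c l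

variable {c : ℕ → ℝ}

/-- The total mass minus the union of the sets outside `A k` is the mass of the atoms with `A l ⊆ A
k`. The entries of the real array `3` for these `l` are then subtracted; entries not yet computed
are expected to hold `0`. -/
theorem runs_atomProg {s : State} {k : ℕ} (hO : IsUnionOracle m A c O) (hs : s.HasInput n m A)
    (hA : ∀ k < m, A k ⊆ Finset.range n) (h4 : s.natVar 4 = k) (hk : k < m)
    (hT : s.realVar 1 = ∑ l ∈ Finset.range m, c l) :
    Runs O atomProg s fun s' t q => q = 1 ∧ t ≤ 22 * (m * n) + 27 * m + 22 * n + 30 ∧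
      s'.realArr 3 = Function.update (s.realArr 3) k
        (∑ l ∈ (Finset.range m).filter (fun l => A l ⊆ A k), c l
          - ∑ l ∈ (Finset.range m).filter (fun l => A l ⊆ A k), s.realArr 3 l) := by
  rw [atomProg, runs_seq]
  refine (Runs.forLoop n (fun j s' t q => q = 0 ∧ t ≤ 15 * j ∧
    ∀ i < j, s'.natArr 4 i = 1 - if i ∈ A k then 1 else 0) rfl ?_ ?_ ?_ ?_).conseq ?_
  · intro k s t c x h; exact h
  · intro s' hf
    exact (hf.nv 0 rfl).trans hs.nv0
  · exact ⟨rfl, by simp, by simp⟩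
  · rintro j s₂ t₂ c₂ hj hf₂ g5 ⟨rfl, ht₂, h7⟩
    have gs₂ : s₂.HasInput n m A := hs.of_frame hf₂ rfl rfl rfl rfl rfl rfl rfl
    have g4 : s₂.natVar 4 = k := (hf₂.nv 4 rfl).trans h4
    simp only [runs_writeNat, NatExpr.eval, NatExpr.cost, incAddr, g4, g5, gs₂.row k hk,
      gs₂.inc k hk j hj, Function.update_self]
    refine ⟨trivial, by omega, fun i hi => ?_⟩
    by_cases hij : i = j
    · subst hij; rw [Function.update_self]
    · rw [Function.update_of_ne hij, h7 i (by omega)]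
  rintro s₁ t₁ c₁ hf₁ ⟨t₁', ⟨rfl, ht₁, hflags⟩, rfl⟩
  have gs₁ : s₁.HasInput n m A := hs.of_frame hf₁ rfl rfl rfl rfl rfl rfl rfl
  have hU : s₁.realVar 1 - O (s₁.natArr 4)
      = ∑ l ∈ (Finset.range m).filter (fun l => A l ⊆ A k), c l := by
    rw [hf₁.rv 1 rfl, hT, hO, sub_eq_iff_eq_add,
      ← Finset.sum_filter_add_sum_filter_not _ (fun l => A l ⊆ A k)]
    congr 1
    refine Finset.sum_congr (Finset.filter_congr fun l hl => ?_) fun _ _ => rfl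
    rw [Finset.not_subset]
    refine exists_congr fun j => and_congr_right fun hj => ?_
    rw [hflags j (Finset.mem_range.1 (hA l (Finset.mem_range.1 hl) hj))]
    by_cases h : j ∈ A k <;> simp [h]
  rw [runs_seq, runs_query, runs_seq, runs_setReal, runs_seq]
  simp only [RealExpr.eval, RealExpr.cost]
  set s₂ : State := { s₁ with
    realVar := Function.update (Function.update s₁.realVar 2 (O (s₁.natArr 4))) 2
      (Function.update s₁.realVar 2 (O (s₁.natArr 4)) 1
        - Function.update s₁.realVar 2 (O (s₁.natArr 4)) 2) } with hs₂
  have gs₂ : s₂.HasInput n m A := ⟨gs₁.nv0, gs₁.nv1, gs₁.inc, gs₁.row,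
    ⟨gs₁.offsets.sink, gs₁.offsets.size, gs₁.offsets.offset⟩⟩
  have g4 : s₂.natVar 4 = k := (hf₁.nv 4 rfl).trans h4
  have gr : s₂.realArr 3 = s.realArr 3 := hf₁.ra 3 rfl
  have g2 : s₂.realVar 2 = ∑ l ∈ (Finset.range m).filter (fun l => A l ⊆ A k), c l := by
    rw [← hU]; simp [hs₂]
  clear_value s₂
  refine (Runs.forLoop m (fun i s' t q => q = 0 ∧ t ≤ 22 * (i * n) + 20 * i ∧
    s'.realVar 2 = ∑ l ∈ (Finset.range m).filter (fun l => A l ⊆ A k), c l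
      - ∑ l ∈ (Finset.range i).filter (fun l => A l ⊆ A k), s.realArr 3 l)
    rfl ?_ ?_ ?_ ?_).conseq ?_
  · intro k s t c x h; exact h
  · intro s' hf
    exact (hf.nv 1 rfl).trans gs₂.nv1
  · exact ⟨rfl, by simp, by simp [g2]⟩
  · rintro l s₃ t₃ c₃ hl hf₃ g6 ⟨rfl, ht₃, h2⟩
    have gs₃ : s₃.HasInput n m A := gs₂.of_frame hf₃ rfl rfl rfl rfl rfl rfl rfl
    have g4₃ : s₃.natVar 4 = k := (hf₃.nv 4 rfl).trans g4
    rw [runs_seq]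
    refine (runs_diffProg gs₃ hA g4₃ g6 hk hl).conseq ?_
    rintro s₄ t₄ c₄ hf₄ ⟨rfl, ht₄, h7⟩
    have g6₄ : s₄.natVar 6 = l := (hf₄.nv 6 rfl).trans g6
    have g2₄ : s₄.realVar 2 = s₃.realVar 2 := hf₄.rv 2 rfl
    have gr₄ : s₄.realArr 3 = s.realArr 3 := (hf₄.ra 3 rfl).trans ((hf₃.ra 3 rfl).trans gr)
    rw [runs_ite]
    simp only [runs_setReal, runs_skip, Cond.Holds, NatExpr.eval, RealExpr.eval, Cond.cost,
      NatExpr.cost, RealExpr.cost, Nat.succ_mul, g6₄, g2₄, gr₄, h2, sum_filter_range_succ,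
      Function.update_self, h7]
    refine ⟨fun h => ⟨trivial, by omega, ?_⟩, fun h => ⟨trivial, by omega, ?_⟩⟩
    · rw [if_pos h]; ring
    · rw [if_neg h]; ring
  · rintro s₃ t₃ c₃ hf₃ ⟨t₃', ⟨rfl, ht₃, h2⟩, rfl⟩
    have g4₃ : s₃.natVar 4 = k := (hf₃.nv 4 rfl).trans g4
    have gr₃ : s₃.realArr 3 = s.realArr 3 := (hf₃.ra 3 rfl).trans gr
    simp only [runs_writeReal, NatExpr.eval, RealExpr.eval, NatExpr.cost, RealExpr.cost, g4₃,
      gr₃, h2, Function.update_self]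
    exact ⟨by norm_num, by omega, trivial⟩

/-- The measures of all atoms, by increasing cardinality. -/
def measureProg : Prog :=
  .seq sizeProg
  (.seq (forLoop 5 (.var 0) (.writeNat 4 (.var 5) (.const 1)))
  (.seq (.query 1 4)
    (forLoop 10 (.add (.var 0) (.const 1)) (forLoop 4 (.var 1)
      (.ite (.natEq (.read 3 (.var 4)) (.var 10)) atomProg .skip)))))

/-- When the turn of `A k` comes, every listed proper subset has smaller cardinality and is already
known, and the entry of `A k` itself is still `0`. So the difference formed by `atomProg` collapses
to `c k`. Injectivity of the list makes the other listed subsets proper. -/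
theorem runs_measureProg {s : State} (hO : IsUnionOracle m A c O) (hs : s.HasInput n m A)
    (hA : ∀ k < m, A k ⊆ Finset.range n) (hne : ∀ k < m, (A k).Nonempty)
    (hinj : ∀ k < m, ∀ l < m, A k = A l → k = l) (h3 : s.natArr 3 = fun _ => 0)
    (hr3 : s.realArr 3 = fun _ => 0) :
    Runs O measureProg s fun s' t q => q = m + 1 ∧
      t ≤ 22 * (m * n) + 12 * m + 100 + 40 * n + (n + 1) * (15 * m + 20)
        + (22 * (m * n) + 27 * m + 22 * n + 30) * m ∧
      ∀ k < m, s'.realArr 3 k = c k := by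
  set W := 22 * (m * n) + 27 * m + 22 * n + 30 with hW
  rw [measureProg, runs_seq]
  refine (runs_sizeProg hs hA h3).conseq ?_
  rintro s₁ t₁ c₁ hf₁ ⟨rfl, ht₁, hsize⟩
  have gs₁ : s₁.HasInput n m A := hs.of_frame hf₁ rfl rfl rfl rfl rfl rfl rfl
  rw [runs_seq]
  refine (Runs.forLoop n (fun j s' t q => q = 0 ∧ t ≤ 15 * j ∧ ∀ i < j, s'.natArr 4 i = 1)
    rfl ?_ ?_ ?_ ?_).conseq ?_
  · intro k s t c x h; exact h
  · intro s' hf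
    exact (hf.nv 0 rfl).trans gs₁.nv0
  · exact ⟨rfl, by simp, by simp⟩
  · rintro j s₂ t₂ c₂ hj hf₂ g5 ⟨rfl, ht₂, h7⟩
    simp only [runs_writeNat, NatExpr.eval, NatExpr.cost, g5, Function.update_self]
    refine ⟨trivial, by omega, fun i hi => ?_⟩
    by_cases hij : i = j
    · subst hij; rw [Function.update_self]
    · rw [Function.update_of_ne hij, h7 i (by omega)]
  rintro s₂ t₂ c₂ hf₂ ⟨t₂', ⟨rfl, ht₂, hflags⟩, rfl⟩
  have gs₂ : s₂.HasInput n m A := gs₁.of_frame hf₂ rfl rfl rfl rfl rfl rfl rfl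
  have hT : O (s₂.natArr 4) = ∑ l ∈ Finset.range m, c l := by
    rw [hO, Finset.filter_true_of_mem]
    intro l hl
    rw [Finset.mem_range] at hl
    obtain ⟨j, hj⟩ := hne l hl
    exact ⟨j, hj, by rw [hflags j (Finset.mem_range.1 (hA l hl hj))]; exact one_ne_zero⟩
  rw [runs_seq, runs_query, hT]
  set s₃ : State := { s₂ with
    realVar := Function.update s₂.realVar 1 (∑ l ∈ Finset.range m, c l) } with hs₃
  have gs₃ : s₃.HasInput n m A := ⟨gs₂.nv0, gs₂.nv1, gs₂.inc, gs₂.row,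
    ⟨gs₂.offsets.sink, gs₂.offsets.size, gs₂.offsets.offset⟩⟩
  have gT : s₃.realVar 1 = ∑ l ∈ Finset.range m, c l := by simp [hs₃]
  have g3 : ∀ k < m, s₃.natArr 3 k = (A k).card := by
    intro k hk
    rw [← hsize k hk, ← hf₂.na 3 rfl]
  have gr3 : s₃.realArr 3 = fun _ => 0 := (hf₂.ra 3 rfl).trans ((hf₁.ra 3 rfl).trans hr3)
  clear_value s₃
  -- The expensive part `W` is charged to the oracle calls `q`, of which there is one per atom; the
  -- other turns of the two nested loops cost only a comparison.
  refine (Runs.forLoop (n + 1) (fun z s' t q =>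
      q = ((Finset.range m).filter fun l => (A l).card < z).card ∧
      t ≤ z * (14 * m + 10) + W * q ∧
      ∀ l < m, s'.realArr 3 l = if (A l).card < z then c l else 0) rfl ?_ ?_ ?_ ?_).mono ?_
  · intro k s t c x h; exact h
  · intro s' hf
    simp only [NatExpr.eval]
    rw [hf.nv 0 rfl, gs₃.nv0]
  · exact ⟨by simp, by simp, by simp [gr3]⟩
  · rintro z s₄ t₄ c₄ hz hf₄ g10 ⟨hc₄, ht₄, hr₄⟩
    have gs₄ : s₄.HasInput n m A := gs₃.of_frame hf₄ rfl rfl rfl rfl rfl rfl rfl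
    have gT₄ : s₄.realVar 1 = ∑ l ∈ Finset.range m, c l := (hf₄.rv 1 rfl).trans gT
    have g3₄ : ∀ k < m, s₄.natArr 3 k = (A k).card := by rw [hf₄.na 3 rfl]; exact g3
    refine (Runs.forLoop m (fun k s' t q =>
      q = ((Finset.range k).filter fun l => (A l).card = z).card ∧
      t ≤ 7 * k + W * q ∧
      ∀ l < m, s'.realArr 3 l =
        if (A l).card < z ∨ ((A l).card = z ∧ l < k) then c l else 0) rfl ?_ ?_ ?_ ?_).mono ?_
    · intro k s t c x h; exact h
    · intro s' hf
      exact (hf.nv 1 rfl).trans gs₄.nv1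
    · exact ⟨by simp, by simp, by simpa using hr₄⟩
    · rintro k s₅ t₅ c₅ hk hf₅ g4 ⟨hc₅, ht₅, hr₅⟩
      have gs₅ : s₅.HasInput n m A := gs₄.of_frame hf₅ rfl rfl rfl rfl rfl rfl rfl
      have gT₅ : s₅.realVar 1 = ∑ l ∈ Finset.range m, c l := (hf₅.rv 1 rfl).trans gT₄
      have g3₅ : s₅.natArr 3 k = (A k).card := by rw [hf₅.na 3 rfl]; exact g3₄ k hk
      have g10₅ : s₅.natVar 10 = z := (hf₅.nv 10 rfl).trans g10
      rw [runs_ite]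
      simp only [runs_skip, Cond.Holds, NatExpr.eval, Cond.cost, NatExpr.cost, g4, g3₅, g10₅,
        card_filter_range_succ]
      refine ⟨fun hkz => ?_, fun hkz => ⟨?_, by simp only [Nat.add_zero]; omega, fun l hl => ?_⟩⟩
      · refine (runs_atomProg hO gs₅ hA g4 hk gT₅).mono ?_
        rintro s₆ t₆ c₆ ⟨rfl, ht₆, hr₆⟩
        refine ⟨by rw [if_pos hkz, hc₅], ?_, fun l hl => ?_⟩
        · rw [Nat.mul_succ W]; omega
        · rw [hr₆]
          by_cases hlk : l = k
          · subst hlk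
            rw [Function.update_self, if_pos (.inr ⟨hkz, Nat.lt_succ_self _⟩),
              ← Finset.sum_sub_distrib, Finset.sum_eq_single_of_mem l]
            · rw [hr₅ l hk, if_neg (by omega), sub_zero]
            · simp [hk]
            · intro i hi hil
              rw [Finset.mem_filter, Finset.mem_range] at hi
              have hlt : (A i).card < (A l).card := Finset.card_lt_card
                (lt_of_le_of_ne hi.2 fun h => hil (hinj i hi.1 l hk h))
              rw [hr₅ i hi.1, if_pos (.inl (by omega)), sub_self]
          · rw [Function.update_of_ne hlk, hr₅ l hl]
            refine if_congr ?_ rfl rfl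
            omega
      · rw [if_neg hkz, hc₅]
      · rw [hr₅ l hl]
        refine if_congr ?_ rfl rfl
        rcases eq_or_ne l k with rfl | hlk <;> omega
    · rintro s₅ t₅ c₅ ⟨t₅', ⟨rfl, ht₅, hr₅⟩, rfl⟩
      refine ⟨?_, ?_, fun l hl => ?_⟩
      · rw [hc₄, ← Finset.card_union_of_disjoint]
        · congr 1
          ext l
          simp only [Finset.mem_union, Finset.mem_filter, Finset.mem_range]
          omega
        · rw [Finset.disjoint_filter]
          intro l _ h; omega
      · rw [Nat.succ_mul, Nat.mul_add W]
        simp only [NatExpr.cost]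
        omega
      · rw [hr₅ l hl]
        refine if_congr ?_ rfl rfl
        omega
  · rintro s₄ t₄ c₄ ⟨t₄', ⟨hc₄, ht₄, hr₄⟩, rfl⟩
    have hlt : ∀ l < m, (A l).card < n + 1 := fun l hl => by
      have := Finset.card_le_card (hA l hl)
      rw [Finset.card_range] at this; omega
    have hq : c₄ = m := by
      rw [hc₄, Finset.filter_true_of_mem fun l hl => hlt l (Finset.mem_range.1 hl),
        Finset.card_range]
    subst hq
    refine ⟨by omega, ?_, fun k hk => by rw [hr₄ k hk, if_pos (hlt k hk)]⟩
    simp only [NatExpr.cost]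
    simp only [Nat.mul_add] at ht₄ ⊢
    nlinarith

end

section

/-! ## The network of a collection

The set number `j` is the vertex `j`, the atom number `k` is the vertex `n + k`, and the sink is
the vertex `n + m`. Flows are sent backwards, from the sets to the atoms. -/

/-- The capacities that belong to the first `k` atoms. -/
def initCap (n m : ℕ) (A : ℕ → Finset ℕ) (c : ℕ → ℝ) (k v w : ℕ) : ℝ :=
  if v < n then (if n ≤ w ∧ w < n + k ∧ v ∈ A (w - n) then c (w - n) else 0)
  else if v < n + k ∧ w = n + m then c (v - n) else 0

/-- The part of the demands that comes from the first `k` atoms. -/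
noncomputable def initExcess (n : ℕ) (A : ℕ → Finset ℕ) (c : ℕ → ℝ) (Λ : ℝ) (k v : ℕ) : ℝ :=
  if v < n then ∑ l ∈ (Finset.range k).filter (fun l => v ∈ A l), c l / Λ else 0

/-- Write the capacities, the excesses and the total excess. -/
def initProg : Prog :=
  forLoop 4 (.var 1) (.seq (.setNat 8 (.add (.var 0) (.var 4)))
    (.seq (forLoop 5 (.var 0) (.ite (.natEq (.read 0 (incAddr 4 5)) (.const 0)) .skip
      (.seq (.writeReal 1 (arcAddr 5 8) (.read 3 (.var 4)))
      (.seq (.writeReal 2 (.var 5) (.add (.read 2 (.var 5)) (.div (.read 3 (.var 4)) (.var 0))))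
        (.setReal 4 (.add (.var 4) (.div (.read 3 (.var 4)) (.var 0))))))))
      (.writeReal 1 (arcAddr 8 2) (.read 3 (.var 4)))))

variable {O : (ℕ → ℕ) → ℝ} {n m : ℕ} {A : ℕ → Finset ℕ} {c : ℕ → ℝ} {Λ : ℝ}

theorem sum_update_add {N j : ℕ} (hj : j < N) (f : ℕ → ℝ) (x : ℝ) :
    ∑ v ∈ Finset.range N, Function.update f j (f j + x) v = ∑ v ∈ Finset.range N, f v + x := by
  have hj' : j ∈ Finset.range N := Finset.mem_range.2 hj
  rw [Finset.sum_update_of_mem hj', ← Finset.add_sum_erase _ f hj', Finset.sdiff_singleton_eq_erase]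
  ring

/-- The arc from a set to an atom gets the capacity `c k` in place of `∞`; the cut condition still
holds with it. The demand of a set is accumulated atom by atom, so no oracle call is needed for it.
-/
theorem runs_initProg {s : State} (hs : s.HasInput n m A) (hc : ∀ k < m, s.realArr 3 k = c k)
    (hΛ : s.realVar 0 = Λ) (h4 : s.realVar 4 = 0) (hr : s.realArr 1 = fun _ => 0)
    (he : s.realArr 2 = fun _ => 0) :
    Runs O initProg s fun s' t q => q = 0 ∧ t ≤ 60 * (m * n) + 60 * m + 5 ∧
      (∀ v < n + m + 1, ∀ w < n + m + 1, (s'.preflow (n + m)).r v w = initCap n m A c m v w) ∧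
      (∀ v, (s'.preflow (n + m)).e v = initExcess n A c Λ m v) ∧
      s'.realVar 4 = ∑ v ∈ Finset.range (n + m + 1), (s'.preflow (n + m)).e v := by
  refine (Runs.forLoop m (fun k s' t q => q = 0 ∧ t ≤ 60 * (k * n) + 30 * k ∧
      (∀ v < n + m + 1, ∀ w < n + m + 1, (s'.preflow (n + m)).r v w = initCap n m A c k v w) ∧
      (∀ v, (s'.preflow (n + m)).e v = initExcess n A c Λ k v) ∧
      s'.realVar 4 = ∑ v ∈ Finset.range (n + m + 1), (s'.preflow (n + m)).e v)
    rfl ?_ ?_ ?_ ?_).mono ?_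
  · intro k s t c x h; exact h
  · intro s' hf
    exact (hf.nv 1 rfl).trans hs.nv1
  · refine ⟨rfl, by simp, ?_, ?_, ?_⟩
    · intro v _ w _
      simp only [State.preflow, hr, initCap]
      split_ifs <;> first | rfl | omega
    · intro v
      simp [State.preflow, he, initExcess]
    · simp [State.preflow, he, h4]
  · rintro k s₁ t₁ c₁ hk hf₁ g4 ⟨rfl, ht₁, hr₁, he₁, hD₁⟩
    have gs₁ : s₁.HasInput n m A := hs.of_frame hf₁ rfl rfl rfl rfl rfl rfl rfl
    have gc₁ : ∀ k < m, s₁.realArr 3 k = c k := by rw [hf₁.ra 3 rfl]; exact hc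
    have gΛ₁ : s₁.realVar 0 = Λ := (hf₁.rv 0 rfl).trans hΛ
    rw [runs_seq, runs_setNat, runs_seq]
    simp only [NatExpr.eval, NatExpr.cost, gs₁.nv0, g4]
    set s₂ : State := { s₁ with natVar := Function.update s₁.natVar 8 (n + k) } with hs₂
    have gs₂ : s₂.HasInput n m A := ⟨gs₁.nv0, gs₁.nv1, gs₁.inc, gs₁.row,
      ⟨gs₁.offsets.sink, gs₁.offsets.size, gs₁.offsets.offset⟩⟩
    have g8 : s₂.natVar 8 = n + k := by simp [hs₂]
    have g4₂ : s₂.natVar 4 = k := g4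
    refine (Runs.forLoop n (fun j s' t q => q = 0 ∧ t ≤ 50 * j ∧
      (∀ v < n + m + 1, ∀ w < n + m + 1, (s'.preflow (n + m)).r v w =
        if v < j ∧ w = n + k ∧ v ∈ A k then c k else initCap n m A c k v w) ∧
      (∀ v, (s'.preflow (n + m)).e v =
        initExcess n A c Λ k v + if v < j ∧ v ∈ A k then c k / Λ else 0) ∧
      s'.realVar 4 = ∑ v ∈ Finset.range (n + m + 1), (s'.preflow (n + m)).e v)
      rfl ?_ ?_ ?_ ?_).conseq ?_
    · intro k s t c x h; exact h
    · intro s' hf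
      exact (hf.nv 0 rfl).trans gs₂.nv0
    · refine ⟨rfl, by simp, ?_, ?_, hD₁⟩
      · intro v hv w hw
        rw [if_neg fun h => absurd h.1 (Nat.not_lt_zero v)]
        exact hr₁ v hv w hw
      · intro v
        rw [if_neg fun h => absurd h.1 (Nat.not_lt_zero v), add_zero]
        exact he₁ v
    · rintro j s₃ t₃ c₃ hj hf₃ g5 ⟨rfl, ht₃, hr₃, he₃, hD₃⟩
      have gs₃ : s₃.HasInput n m A := gs₂.of_frame hf₃ rfl rfl rfl rfl rfl rfl rfl
      have g4₃ : s₃.natVar 4 = k := (hf₃.nv 4 rfl).trans g4₂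
      have g8₃ : s₃.natVar 8 = n + k := (hf₃.nv 8 rfl).trans g8
      have gc₃ : s₃.realArr 3 k = c k := by rw [hf₃.ra 3 rfl]; exact gc₁ k hk
      have gΛ₃ : s₃.realVar 0 = Λ := (hf₃.rv 0 rfl).trans gΛ₁
      rw [runs_ite]
      simp only [Cond.Holds, NatExpr.eval, incAddr, g4₃, g5, gs₃.row k hk, gs₃.inc k hk j hj]
      refine ⟨fun hjk => ?_, fun hjk => ?_⟩
      · have hjk : j ∉ A k := by simpa using hjk
        rw [runs_skip]
        refine ⟨rfl, ?_, fun v hv w hw => ?_, fun v => ?_, hD₃⟩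
        · simp only [Cond.cost, NatExpr.cost]; omega
        · rw [hr₃ v hv w hw]
          refine if_congr ?_ rfl rfl
          rw [Nat.lt_succ_iff_lt_or_eq]
          constructor
          · rintro ⟨h1, h2⟩; exact ⟨.inl h1, h2⟩
          · rintro ⟨h1 | rfl, h2, h3⟩
            · exact ⟨h1, h2, h3⟩
            · exact absurd h3 hjk
        · rw [he₃ v]
          congr 1
          refine if_congr ?_ rfl rfl
          rw [Nat.lt_succ_iff_lt_or_eq]
          constructor
          · rintro ⟨h1, h2⟩; exact ⟨.inl h1, h2⟩
          · rintro ⟨h1 | rfl, h3⟩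
            · exact ⟨h1, h3⟩
            · exact absurd h3 hjk
      · have hjk : j ∈ A k := by simpa using hjk
        simp only [runs_seq, runs_writeReal, runs_setReal, arcAddr, NatExpr.eval, RealExpr.eval,
          g5, g8₃, g4₃, gs₃.offsets.offset j (by omega)]
        have e31 : (3 : ℕ) ≠ 1 := by norm_num
        have e32 : (3 : ℕ) ≠ 2 := by norm_num
        have e21 : (2 : ℕ) ≠ 1 := by norm_num
        simp only [Function.update_of_ne e31, Function.update_of_ne e32, Function.update_of_ne e21,
          gc₃, gΛ₃]
        refine ⟨trivial, ?_, fun v hv w hw => ?_, fun v => ?_, ?_⟩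
        · simp only [Cond.cost, NatExpr.cost, RealExpr.cost]; omega
        · simp only [State.preflow, Function.update_self, Function.update_of_ne e21.symm]
          by_cases hvw : v = j ∧ w = n + k
          · obtain ⟨rfl, rfl⟩ := hvw
            rw [Function.update_self, if_pos ⟨Nat.lt_succ_self _, rfl, hjk⟩]
          · have hne : v * (n + m + 1) + w ≠ j * (n + m + 1) + (n + k) := fun h =>
              hvw (addr_inj hw (by omega) h)
            rw [Function.update_of_ne hne]
            refine (hr₃ v hv w hw).trans (if_congr ?_ rfl rfl)
            rw [Nat.lt_succ_iff_lt_or_eq]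
            tauto
        · simp only [State.preflow, Function.update_self]
          by_cases hvj : v = j
          · subst hvj
            have := he₃ v
            rw [if_neg (by simp), add_zero] at this
            rw [Function.update_self, if_pos ⟨Nat.lt_succ_self _, hjk⟩, ← this]
            rfl
          · rw [Function.update_of_ne hvj]
            refine (he₃ v).trans ?_
            congr 1
            refine if_congr ?_ rfl rfl
            rw [Nat.lt_succ_iff_lt_or_eq]
            tauto
        · simp only [State.preflow, Function.update_self]
          rw [sum_update_add (by omega), hD₃]
          rfl
    · rintro s₃ t₃ c₃ hf₃ ⟨t₃', ⟨rfl, ht₃, hr₃, he₃, hD₃⟩, rfl⟩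
      have gs₃ : s₃.HasInput n m A := gs₂.of_frame hf₃ rfl rfl rfl rfl rfl rfl rfl
      have g4₃ : s₃.natVar 4 = k := (hf₃.nv 4 rfl).trans g4₂
      have g8₃ : s₃.natVar 8 = n + k := (hf₃.nv 8 rfl).trans g8
      have gc₃ : s₃.realArr 3 k = c k := by rw [hf₃.ra 3 rfl]; exact gc₁ k hk
      have e21 : (2 : ℕ) ≠ 1 := by norm_num
      simp only [runs_writeReal, arcAddr, NatExpr.eval, RealExpr.eval, NatExpr.cost,
        RealExpr.cost, g4₃, g8₃, gc₃, gs₃.offsets.offset (n + k) (by omega), gs₃.offsets.sink]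
      refine ⟨trivial, ?_, fun v hv w hw => ?_, fun v => ?_, ?_⟩
      · have : (k + 1) * n = k * n + n := Nat.succ_mul k n
        omega
      · simp only [State.preflow, Function.update_self]
        by_cases hvw : v = n + k ∧ w = n + m
        · obtain ⟨rfl, rfl⟩ := hvw
          rw [Function.update_self, initCap, if_neg (by omega), if_pos (by omega)]
          congr 1; omega
        · have hne : v * (n + m + 1) + w ≠ (n + k) * (n + m + 1) + (n + m) := fun h =>
            hvw (addr_inj hw (by omega) h)
          rw [Function.update_of_ne hne]
          refine (hr₃ v hv w hw).trans ?_
          simp only [initCap]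
          by_cases hvn : v < n
          · rw [if_pos hvn, if_pos hvn]
            by_cases hwk : w = n + k
            · subst hwk
              have hnk : n + k - n = k := by omega
              rw [hnk, if_neg (c := n ≤ n + k ∧ n + k < n + k ∧ v ∈ A k) (by omega)]
              refine if_congr ⟨fun h => ⟨by omega, by omega, h.2.2⟩, fun h => ⟨hvn, rfl, h.2.2⟩⟩
                rfl rfl
            · rw [if_neg fun h => hwk h.2.1]
              refine if_congr ⟨fun h => ⟨h.1, by omega, h.2.2⟩, fun h => ⟨h.1, by omega, h.2.2⟩⟩
                rfl rfl
          · rw [if_neg fun h => hvn h.1, if_neg hvn, if_neg hvn]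
            refine if_congr ?_ rfl rfl
            omega
      · simp only [State.preflow, Function.update_of_ne e21]
        refine (he₃ v).trans ?_
        simp only [initExcess]
        by_cases hvn : v < n
        · rw [if_pos hvn, if_pos hvn, sum_filter_range_succ (fun l => v ∈ A l)]
          congr 1
          exact if_congr ⟨fun h => h.2, fun h => ⟨hvn, h⟩⟩ rfl rfl
        · rw [if_neg hvn, if_neg hvn, if_neg fun h => hvn h.1, add_zero]
      · simp only [State.preflow, Function.update_of_ne e21]
        exact hD₃
  · rintro s₂ t₂ c₂ ⟨t', ⟨rfl, ht', h⟩, rfl⟩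
    refine ⟨rfl, ?_, h⟩
    simp only [NatExpr.cost]; omega

/-- Write the values of the functions. -/
def outputProg : Prog :=
  forLoop 4 (.var 1) (.seq (.setNat 8 (.add (.var 0) (.var 4)))
    (forLoop 5 (.var 0)
      (.writeReal 0 (incAddr 4 5) (.div (.read 1 (arcAddr 8 5)) (.read 3 (.var 4))))))

/-- The arc from the atom `k` back to the set `j` starts with capacity `0`, so its residual capacity
is the amount sent from `j` to `k`. Division by zero gives `0` here as in `phi`. -/
theorem runs_outputProg {s : State} (hs : s.HasInput n m A)
    (hc : ∀ k < m, s.realArr 3 k = c k) :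
    Runs O outputProg s fun s' t q => q = 0 ∧ t ≤ 40 * (m * n) + 40 * m + 5 ∧
      ∀ k < m, ∀ j < n, s'.realArr 0 (k * n + j) = (s.preflow (n + m)).r (n + k) j / c k := by
  refine (Runs.forLoop m (fun k s' t q => q = 0 ∧ t ≤ 40 * (k * n) + 20 * k ∧
      ∀ l < k, ∀ j < n, s'.realArr 0 (l * n + j) = (s.preflow (n + m)).r (n + l) j / c l)
    rfl ?_ ?_ ?_ ?_).mono ?_
  · intro k s t c x h; exact h
  · intro s' hf
    exact (hf.nv 1 rfl).trans hs.nv1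
  · exact ⟨rfl, by simp, by simp⟩
  · rintro k s₁ t₁ c₁ hk hf₁ g4 ⟨rfl, ht₁, hout₁⟩
    have gs₁ : s₁.HasInput n m A := hs.of_frame hf₁ rfl rfl rfl rfl rfl rfl rfl
    rw [runs_seq, runs_setNat]
    simp only [NatExpr.eval, NatExpr.cost, gs₁.nv0, g4]
    set s₂ : State := { s₁ with natVar := Function.update s₁.natVar 8 (n + k) } with hs₂
    have gs₂ : s₂.HasInput n m A := ⟨gs₁.nv0, gs₁.nv1, gs₁.inc, gs₁.row,
      ⟨gs₁.offsets.sink, gs₁.offsets.size, gs₁.offsets.offset⟩⟩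
    have g8 : s₂.natVar 8 = n + k := by simp [hs₂]
    have g4₂ : s₂.natVar 4 = k := g4
    refine (Runs.forLoop n (fun i s' t q => q = 0 ∧ t ≤ 30 * i ∧
      ∀ l < m, ∀ j < n, l < k ∨ (l = k ∧ j < i) →
        s'.realArr 0 (l * n + j) = (s.preflow (n + m)).r (n + l) j / c l) rfl ?_ ?_ ?_ ?_).mono ?_
    · intro k s t c x h; exact h
    · intro s' hf
      exact (hf.nv 0 rfl).trans gs₂.nv0
    · exact ⟨rfl, by simp, fun l _ j hj h => hout₁ l (by omega) j hj⟩
    · rintro i s₃ t₃ c₃ hi hf₃ g5 ⟨rfl, ht₃, hout₃⟩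
      have gs₃ : s₃.HasInput n m A := gs₂.of_frame hf₃ rfl rfl rfl rfl rfl rfl rfl
      have g4₃ : s₃.natVar 4 = k := (hf₃.nv 4 rfl).trans g4₂
      have g8₃ : s₃.natVar 8 = n + k := (hf₃.nv 8 rfl).trans g8
      have gc₃ : s₃.realArr 3 k = c k := by
        rw [hf₃.ra 3 rfl, ← hc k hk, ← hf₁.ra 3 rfl]
      have gr₃ : s₃.realArr 1 = s.realArr 1 := (hf₃.ra 1 rfl).trans (hf₁.ra 1 rfl)
      simp only [runs_writeReal, arcAddr, incAddr, NatExpr.eval, RealExpr.eval, NatExpr.cost,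
        RealExpr.cost, g4₃, g5, g8₃, gc₃, gr₃, gs₃.row k hk,
        gs₃.offsets.offset (n + k) (by omega), Function.update_self]
      refine ⟨trivial, by omega, fun l hl j hj hlj => ?_⟩
      by_cases h : l = k ∧ j = i
      · obtain ⟨rfl, rfl⟩ := h
        rw [Function.update_self]
        rfl
      · rw [Function.update_of_ne fun h' => h (addr_inj hj hi h')]
        exact hout₃ l hl j hj (by omega)
    · rintro s₃ t₃ c₃ ⟨t₃', ⟨rfl, ht₃, hout₃⟩, rfl⟩
      refine ⟨rfl, ?_, fun l hl j hj => hout₃ l (by omega) j hj (by omega)⟩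
      have : (k + 1) * n = k * n + n := Nat.succ_mul k n
      simp only [NatExpr.cost]
      omega
  · rintro s₂ t₂ c₂ ⟨t', ⟨rfl, ht', h⟩, rfl⟩
    refine ⟨rfl, ?_, h⟩
    simp only [NatExpr.cost]; omega

/-! ## Correctness -/

theorem initCap_nonneg (hc : ∀ k < m, 0 ≤ c k) (v w : ℕ) : 0 ≤ initCap n m A c m v w := by
  simp only [initCap]
  split_ifs with h1 h2 h3
  · exact hc _ (by omega)
  · exact le_rfl
  · exact hc _ (by omega)
  · exact le_rfl

theorem initCap_bipartite {v w : ℕ} (hw : w < n + m)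
    (h : initCap n m A c m v w ≠ 0) : v < n ∧ n ≤ w := by
  simp only [initCap] at h
  split_ifs at h with h1 h2 h3
  · exact ⟨h1, h2.1⟩
  · exact absurd rfl h
  · omega
  · exact absurd rfl h

theorem initCap_sink {k : ℕ} (hk : k < m) : initCap n m A c m (n + k) (n + m) = c k := by
  rw [initCap, if_neg (by omega), if_pos ⟨by omega, rfl⟩, Nat.add_sub_cancel_left]

/-- The Carleson condition is the cut condition. -/
theorem pushProblem_of_carleson (hc : ∀ k < m, 0 ≤ c k) (hΛ : 0 < Λ)
    (hall : ∀ J ⊆ Finset.range n,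
      ∑ j ∈ J, ∑ k ∈ (Finset.range m).filter (fun k => j ∈ A k), c k / Λ
        ≤ ∑ k ∈ (Finset.range m).filter (fun k => ∃ j ∈ A k, j ∈ J), c k) :
    PushProblem (n + m) (initCap n m A c m) (initExcess n A c Λ m) := by
  refine ⟨fun v _ w _ => initCap_nonneg hc v w, fun v _ => ?_, fun S hS => ?_⟩
  · simp only [initExcess]
    split_ifs
    · refine Finset.sum_nonneg fun k hk => div_nonneg (hc k ?_) hΛ.le
      exact Finset.mem_range.1 (Finset.mem_filter.1 hk).1
    · exact le_rfl
  set J := S.filter (· < n) with hJ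
  have h1 : ∑ v ∈ S, initExcess n A c Λ m v
      = ∑ j ∈ J, ∑ k ∈ (Finset.range m).filter (fun k => j ∈ A k), c k / Λ := by
    rw [hJ, Finset.sum_filter]
    rfl
  rw [h1]
  refine (hall J fun j hj => Finset.mem_range.2 (Finset.mem_filter.1 hj).2).trans ?_
  -- the atom `k` is charged to its arc to the sink, or to an arc from a set to it
  set K := (Finset.range m).filter (fun k => ∃ j ∈ A k, j ∈ J) with hK
  have hnn : ∀ p : ℕ × ℕ, 0 ≤ initCap n m A c m p.1 p.2 := fun p => initCap_nonneg hc _ _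
  have hchoice : ∀ k ∈ K, ∃ p : ℕ × ℕ, p ∈ S ×ˢ (Finset.range (n + m + 1) \ S) ∧
      initCap n m A c m p.1 p.2 = c k ∧ ((p.1 = n + k ∧ p.2 = n + m) ∨ (p.1 < n ∧ p.2 = n + k)) := by
    intro k hk
    simp only [hK, hJ, Finset.mem_filter, Finset.mem_range] at hk
    obtain ⟨hkm, j, hjk, hjS, hjn⟩ := hk
    by_cases hkS : n + k ∈ S
    · refine ⟨(n + k, n + m), ?_, ?_, .inl ⟨rfl, rfl⟩⟩
      · rw [Finset.mem_product, Finset.mem_sdiff, Finset.mem_range]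
        refine ⟨hkS, by simp, fun h => ?_⟩
        have := Finset.mem_range.1 (hS h); omega
      · exact initCap_sink hkm
    · refine ⟨(j, n + k), ?_, ?_, .inr ⟨hjn, rfl⟩⟩
      · rw [Finset.mem_product, Finset.mem_sdiff, Finset.mem_range]
        exact ⟨hjS, by simp only []; omega, hkS⟩
      · have hnk : n + k - n = k := by omega
        simp only [initCap, hnk]
        rw [if_pos hjn, if_pos ⟨by omega, by omega, hjk⟩]
  choose! p hp1 hp2 hp3 using hchoice
  -- The atom can be recovered from its arc: `n + k` is the tail if the tail is not a set, and the
  -- head otherwise.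
  have hinj : Set.InjOn p K := by
    intro k hk l hl hkl
    have h₁ := hp3 k hk
    have h₂ := hp3 l hl
    rw [hkl] at h₁
    simp only [hK, Finset.coe_filter, Set.mem_ofPred_eq, Finset.mem_range] at hk hl
    omega
  rw [← Finset.sum_product' (f := fun v w => initCap n m A c m v w)]
  calc ∑ k ∈ K, c k = ∑ k ∈ K, initCap n m A c m (p k).1 (p k).2 :=
        Finset.sum_congr rfl fun k hk => (hp2 k hk).symm
    _ = ∑ q ∈ K.image p, initCap n m A c m q.1 q.2 := by
        rw [Finset.sum_image hinj]
    _ ≤ _ := Finset.sum_le_sum_of_subset_of_nonneg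
        (Finset.image_subset_iff.2 hp1) fun q _ _ => hnn q

/-- The whole program. -/
def mainProg : Prog :=
  .seq setupProg (.seq measureProg (.seq initProg (.seq pushRelabelProg outputProg)))

/-- The leading term is `(n + m)² * min n m`, and `(n + m) * min n m ≤ 2 * (n * m)` brings it down
to the order of `(n + m) * (n * m) = X`. -/
theorem steps_le (hn : 0 < n) (hm : 0 < m) {t₁ t₂ t₃ t₄ t₅ : ℕ}
    (h₁ : t₁ ≤ 32 * (n + m) + 60)
    (h₂ : t₂ ≤ 22 * (m * n) + 12 * m + 100 + 40 * n + (n + 1) * (15 * m + 20)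
        + (22 * (m * n) + 27 * m + 22 * n + 30) * m)
    (h₃ : t₃ ≤ 60 * (m * n) + 60 * m + 5)
    (h₄ : t₄ ≤ (2 * ((n + m) * (2 * min n m + 3)) + 1) * (157 * (n + m) + 20)
      + 100 * ((n + m) * ((2 * min n m + 3) * (n + m + 2) + (n + m + 1))) + 20)
    (h₅ : t₅ ≤ 40 * (m * n) + 40 * m + 5) :
    t₁ + (t₂ + (t₃ + (t₄ + t₅))) ≤ 20000 * (n ^ 2 * m + n * m ^ 2) := by
  set d := min n m with hd
  set X := n ^ 2 * m + n * m ^ 2 with hX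
  have hd1 : 1 ≤ d := le_min hn hm
  have hnm : 1 ≤ n * m := Nat.mul_pos hn hm
  have hMX : (n + m) * (n * m) = X := by rw [hX]; ring
  have hMd : (n + m) * d ≤ 2 * (n * m) := by
    rcases le_total n m with h | h
    · rw [hd, min_eq_left h]; nlinarith
    · rw [hd, min_eq_right h]; nlinarith
  have hMMd : (n + m) * ((n + m) * d) ≤ 2 * X := by
    have := Nat.mul_le_mul_left (n + m) hMd
    linarith
  have hM1 : 2 ≤ n + m := by omega
  have hMX' : n + m ≤ X := by rw [← hMX]; exact Nat.le_mul_of_pos_right _ hnm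
  have hMM : (n + m) * (n + m) ≤ 2 * X := by
    have := Nat.mul_le_mul_left (n + m) (Nat.le_mul_of_pos_right (n + m) hd1)
    linarith
  have hnmX : n * m ≤ X := by rw [← hMX]; exact Nat.le_mul_of_pos_left _ (by omega)
  have hMdX : (n + m) * d ≤ 2 * X := by linarith
  have hmm : m * m ≤ X := by rw [hX]; nlinarith
  have hmmn : m * n * m ≤ X := by rw [hX]; nlinarith
  nlinarith

theorem runs_mainProg (hn : 0 < n) (hm : 0 < m) (hO : IsUnionOracle m A c O)
    (hA : ∀ k < m, A k ⊆ Finset.range n) (hne : ∀ k < m, (A k).Nonempty)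
    (hinj : ∀ k < m, ∀ l < m, A k = A l → k = l)
    (hc : ∀ k < m, 0 ≤ c k) (hΛ : 0 < Λ)
    (hall : ∀ J ⊆ Finset.range n,
      ∑ j ∈ J, ∑ k ∈ (Finset.range m).filter (fun k => j ∈ A k), c k / Λ
        ≤ ∑ k ∈ (Finset.range m).filter (fun k => ∃ j ∈ A k, j ∈ J), c k)
    {s : State} (h0 : s.natVar 0 = n) (h1 : s.natVar 1 = m)
    (hinc : ∀ k < m, ∀ j < n, s.natArr 0 (k * n + j) = if j ∈ A k then 1 else 0)
    (hna : ∀ a, a ≠ 0 → s.natArr a = fun _ => 0) (hrv0 : s.realVar 0 = Λ)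
    (hrv4 : s.realVar 4 = 0) (hra : ∀ a, s.realArr a = fun _ => 0) :
    Runs O mainProg s fun s' t q => q = m + 1 ∧ t ≤ 20000 * (n ^ 2 * m + n * m ^ 2) ∧
      ∃ x : ℕ → ℕ → ℝ, (∀ k < m, ∀ j < n, 0 ≤ x k j) ∧ (∀ k < m, ∀ j < n, j ∉ A k → x k j = 0) ∧
        (∀ k < m, ∑ j ∈ Finset.range n, x k j ≤ c k) ∧
        (∀ j < n, ∑ k ∈ Finset.range m, x k j
          = ∑ k ∈ (Finset.range m).filter (fun k => j ∈ A k), c k / Λ) ∧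
        ∀ k < m, ∀ j < n, s'.realArr 0 (k * n + j) = x k j / c k := by
  have hp := pushProblem_of_carleson hc hΛ hall
  rw [mainProg, runs_seq]
  refine (runs_setupProg h0 h1 hinc (by rw [hna 1 (by norm_num)])
    (by rw [hna 2 (by norm_num)])).conseq ?_
  rintro s₁ t₁ q₁ hf₁ ⟨rfl, ht₁, gs₁⟩
  rw [runs_seq]
  refine (runs_measureProg hO gs₁ hA hne hinj ((hf₁.na 3 rfl).trans (hna 3 (by norm_num)))
    ((hf₁.ra 3 rfl).trans (hra 3))).conseq ?_
  rintro s₂ t₂ q₂ hf₂ ⟨rfl, ht₂, hc₂⟩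
  have gs₂ : s₂.HasInput n m A := gs₁.of_frame hf₂ rfl rfl rfl rfl rfl rfl rfl
  rw [runs_seq]
  refine (runs_initProg gs₂ hc₂ (Λ := Λ) ?_ ?_ ?_ ?_).conseq ?_
  · rw [hf₂.rv 0 rfl, hf₁.rv 0 rfl, hrv0]
  · rw [hf₂.rv 4 rfl, hf₁.rv 4 rfl, hrv4]
  · rw [hf₂.ra 1 rfl, hf₁.ra 1 rfl, hra]
  · rw [hf₂.ra 2 rfl, hf₁.ra 2 rfl, hra]
  rintro s₃ t₃ q₃ hf₃ ⟨rfl, ht₃, hr₃, he₃, hD₃⟩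
  have gs₃ : s₃.HasInput n m A := gs₂.of_frame hf₃ rfl rfl rfl rfl rfl rfl rfl
  have hc₃ : ∀ k < m, s₃.realArr 3 k = c k := by rw [hf₃.ra 3 rfl]; exact hc₂
  -- Either side of the bipartition may serve as `P` in the label bound; using both gives the
  -- minimum of `n` and `m`.
  have hb₁ : BipartiteArcs (n + m) (initCap n m A c m) (Finset.range n) := by
    intro v hv w hw h
    have := initCap_bipartite hw h
    simp only [Finset.mem_range]; omega
  have hb₂ : BipartiteArcs (n + m) (initCap n m A c m) (Finset.Ico n (n + m)) := by
    intro v hv w hw h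
    have := initCap_bipartite hw h
    simp only [Finset.mem_Ico]; omega
  rw [runs_seq]
  refine (runs_pushRelabelProg (L := 2 * min n m + 3) hp ?_ gs₃.offsets hr₃ (fun v _ => he₃ v)
    ?_ ?_ ?_).conseq ?_
  · intro σ hσ v hv he
    have l₁ := hσ.label_le hp hb₁ hv he
    have l₂ := hσ.label_le hp hb₂ hv he
    simp only [Finset.card_range, Nat.card_Ico] at l₁ l₂
    omega
  · exact (hf₃.na 5 rfl).trans ((hf₂.na 5 rfl).trans ((hf₁.na 5 rfl).trans (hna 5 (by norm_num))))
  · exact (hf₃.na 6 rfl).trans ((hf₂.na 6 rfl).trans ((hf₁.na 6 rfl).trans (hna 6 (by norm_num))))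
  · rw [hD₃]; exact Finset.sum_congr rfl fun v _ => he₃ v
  rintro s₄ t₄ q₄ hf₄ ⟨rfl, hval, hzero, ht₄⟩
  have gs₄ : s₄.HasInput n m A := gs₃.of_frame hf₄ rfl rfl rfl rfl rfl rfl rfl
  have hc₄ : ∀ k < m, s₄.realArr 3 k = c k := by rw [hf₄.ra 3 rfl]; exact hc₃
  refine (runs_outputProg gs₄ hc₄).mono ?_
  rintro s₅ t₅ q₅ ⟨rfl, ht₅, hout⟩
  set σ := s₄.preflow (n + m) with hσ
  have hsplit : ∀ f : ℕ → ℝ, ∑ w ∈ Finset.range (n + m + 1), f w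
      = ∑ j ∈ Finset.range n, f j + ∑ k ∈ Finset.range m, f (n + k) + f (n + m) := fun f => by
    rw [Finset.sum_range_succ, Finset.sum_range_add]
  have hcap : ∀ k < m, ∀ j < n, initCap n m A c m (n + k) j = 0 := fun k hk j hj => by
    simp only [initCap]
    rw [if_neg (by omega), if_neg (by omega)]
  have hcap' : ∀ k < m, ∀ j < n, initCap n m A c m j (n + k) = if j ∈ A k then c k else 0 :=
    fun k hk j hj => by
      have hnk : n + k - n = k := by omega
      simp only [initCap, hnk]
      rw [if_pos hj]
      exact if_congr ⟨fun h => h.2.2, fun h => ⟨by omega, by omega, h⟩⟩ rfl rfl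
  have hadd : ∀ k < m, ∀ j < n, σ.r j (n + k) + σ.r (n + k) j = if j ∈ A k then c k else 0 :=
    fun k hk j hj => by
      rw [hval.r_add j (by omega) (n + k) (by omega), hcap k hk j hj, hcap' k hk j hj, add_zero]
  -- The amount sent from `j` to `k` is the residual capacity of the reverse arc. Since no excess is
  -- left, an atom has passed to the sink all that it received, at most `c k`, and a set has sent
  -- away exactly its demand.
  refine ⟨by omega, ?_, fun k j => σ.r (n + k) j, fun k hk j hj => ?_, fun k hk j hj hjk => ?_,
    fun k hk => ?_, fun j hj => ?_, hout⟩
  · exact steps_le hn hm ht₁ ht₂ ht₃ ht₄ ht₅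
  · exact hval.r_nonneg _ (by omega) _ (by omega)
  · have h1 := hadd k hk j hj
    rw [if_neg hjk] at h1
    have h2 := hval.r_nonneg j (by omega) (n + k) (by omega)
    have h3 := hval.r_nonneg (n + k) (by omega) j (by omega)
    exact le_antisymm (by linarith) h3
  · have h1 := hval.e_eq (n + k) (by omega)
    have hatoms : ∀ l ∈ Finset.range m,
        σ.r (n + k) (n + l) - initCap n m A c m (n + k) (n + l) = 0 := by
      intro l hl
      rw [Finset.mem_range] at hl
      have hz : ∀ k l, l < m → initCap n m A c m (n + k) (n + l) = 0 := fun k l hl => by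
        simp only [initCap]
        rw [if_neg (by omega), if_neg (by omega)]
      have h2 := hval.r_add (n + k) (by omega) (n + l) (by omega)
      have h3 := hval.r_nonneg (n + k) (by omega) (n + l) (by omega)
      have h4 := hval.r_nonneg (n + l) (by omega) (n + k) (by omega)
      rw [hz k l hl, hz l k hk] at h2
      rw [hz k l hl]
      linarith
    rw [hzero (n + k) (by omega), hsplit, Finset.sum_eq_zero hatoms, initCap_sink hk, initExcess,
      if_neg (by omega), Finset.sum_sub_distrib,
      Finset.sum_eq_zero (fun j hj => hcap k hk j (Finset.mem_range.1 hj))] at h1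
    have h2 := hval.r_nonneg (n + k) (by omega) (n + m) (by omega)
    linarith
  · have h1 := hval.e_eq j (by omega)
    have hsets : ∀ i ∈ Finset.range n, σ.r j i - initCap n m A c m j i = 0 := by
      intro i hi
      rw [Finset.mem_range] at hi
      have hz : ∀ i j, i < n → j < n → initCap n m A c m j i = 0 := fun i j hi hj => by
        simp only [initCap]
        rw [if_pos hj, if_neg (by omega)]
      have h2 := hval.r_add j (by omega) i (by omega)
      have h3 := hval.r_nonneg j (by omega) i (by omega)
      have h4 := hval.r_nonneg i (by omega) j (by omega)
      rw [hz i j hi hj, hz j i hj hi] at h2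
      rw [hz i j hi hj]
      linarith
    have hsink : σ.r j (n + m) - initCap n m A c m j (n + m) = 0 := by
      have hz : initCap n m A c m j (n + m) = 0 := by
        simp only [initCap]
        rw [if_pos hj, if_neg (by omega)]
      have hz' : initCap n m A c m (n + m) j = 0 := by
        simp only [initCap]
        rw [if_neg (by omega), if_neg (by omega)]
      have h2 := hval.r_add j (by omega) (n + m) (by omega)
      have h3 := hval.r_nonneg j (by omega) (n + m) (by omega)
      have h4 := hval.r_nonneg (n + m) (by omega) j (by omega)
      rw [hz, hz'] at h2
      rw [hz]
      linarith
    rw [hzero j (by omega), hsplit, Finset.sum_eq_zero hsets, hsink, initExcess, if_pos hj] at h1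
    have h2 : ∑ k ∈ Finset.range m, (σ.r j (n + k) - initCap n m A c m j (n + k))
        = - ∑ k ∈ Finset.range m, σ.r (n + k) j := by
      rw [← Finset.sum_neg_distrib]
      refine Finset.sum_congr rfl fun k hk => ?_
      rw [Finset.mem_range] at hk
      rw [hcap' k hk j hj, ← hadd k hk j hj]
      ring
    rw [h2] at h1
    linarith

end

/-! ## Atoms -/

section Atoms

variable {Ω : Type*} {n : ℕ} {Q : Fin n → Set Ω}

theorem mem_atom_iff {A : Finset (Fin n)} {x : Ω} : x ∈ atom Q A ↔ ∀ j, x ∈ Q j ↔ j ∈ A := by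
  simp only [atom, Set.mem_inter_iff, Set.mem_iInter, Finset.mem_compl, Set.mem_compl_iff]
  refine ⟨fun h j => ⟨fun hx => ?_, h.1 j⟩, fun h => ⟨fun j => (h j).2, fun j hj hx =>
    hj ((h j).1 hx)⟩⟩
  by_contra hj
  exact h.2 j hj hx

theorem mem_P0_iff {A : Finset (Fin n)} : A ∈ P0 Q ↔ A.Nonempty ∧ (atom Q A).Nonempty := by
  simp [P0]

theorem atom_disjoint {A B : Finset (Fin n)} (h : A ≠ B) : Disjoint (atom Q A) (atom Q B) := by
  rw [Set.disjoint_left]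
  intro x hA hB
  exact h (Finset.ext fun j => ((mem_atom_iff.1 hA j).symm.trans (mem_atom_iff.1 hB j)))

theorem exists_mem_atom {x : Ω} {j : Fin n} (hx : x ∈ Q j) :
    ∃ A ∈ P0 Q, j ∈ A ∧ x ∈ atom Q A := by
  classical
  have hmem : x ∈ atom Q (Finset.univ.filter fun j => x ∈ Q j) :=
    mem_atom_iff.2 fun j => by simp
  exact ⟨_, mem_P0_iff.2 ⟨⟨j, by simpa using hx⟩, x, hmem⟩, by simpa using hx, hmem⟩

variable [MeasurableSpace Ω] {μ : Measure Ω}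

theorem measurableSet_atom (hQ : ∀ j, MeasurableSet (Q j)) (A : Finset (Fin n)) :
    MeasurableSet (atom Q A) :=
  (Finset.measurableSet_biInter _ fun j _ => hQ j).inter
    (Finset.measurableSet_biInter _ fun j _ => (hQ j).compl)

theorem measure_atom_lt_top (hμ : ∀ j, 0 < μ (Q j) ∧ μ (Q j) < ∞) {A : Finset (Fin n)}
    (hA : A ∈ P0 Q) : μ (atom Q A) < ∞ := by
  obtain ⟨j, hj⟩ := (mem_P0_iff.1 hA).1
  exact (measure_mono fun x hx => ((mem_atom_iff.1 hx j).2 hj)).trans_lt (hμ j).2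

/-- The union is the disjoint union of the atoms whose index set meets `p`. Both the specification
of the oracle and the translation of the Carleson condition into masses of atoms rest on this. -/
theorem measure_iUnion_eq_sum_atom (hQ : ∀ j, MeasurableSet (Q j))
    (hμ : ∀ j, 0 < μ (Q j) ∧ μ (Q j) < ∞) {m : ℕ} (A : Fin m ≃ {A // A ∈ P0 Q})
    (p : Fin n → Prop) [DecidablePred p] :
    μ.real (⋃ (j : Fin n) (_ : p j), Q j)
      = ∑ k : Fin m, if ∃ j ∈ (A k).1, p j then μ.real (atom Q (A k).1) else 0 := by
  have hU : (⋃ (j : Fin n) (_ : p j), Q j)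
      = ⋃ k ∈ Finset.univ.filter (fun k : Fin m => ∃ j ∈ (A k).1, p j), atom Q (A k).1 := by
    ext x
    simp only [Set.mem_iUnion, Finset.mem_filter, Finset.mem_univ, true_and, exists_prop]
    constructor
    · rintro ⟨j, hj, hx⟩
      obtain ⟨B, hB, hjB, hxB⟩ := exists_mem_atom hx
      exact ⟨A.symm ⟨B, hB⟩, ⟨j, by simpa using hjB, hj⟩, by simpa using hxB⟩
    · rintro ⟨k, ⟨j, hjk, hj⟩, hx⟩
      exact ⟨j, hj, (mem_atom_iff.1 hx j).2 hjk⟩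
  rw [hU, measureReal_biUnion_finset _ (fun k _ => measurableSet_atom hQ _)
    (fun k _ => (measure_atom_lt_top hμ (A k).2).ne), Finset.sum_filter]
  intro k _ l _ hkl
  exact atom_disjoint fun h => hkl (A.injective (Subtype.ext h))

theorem measure_set_eq_sum_atom (hQ : ∀ j, MeasurableSet (Q j))
    (hμ : ∀ j, 0 < μ (Q j) ∧ μ (Q j) < ∞) {m : ℕ} (A : Fin m ≃ {A // A ∈ P0 Q}) (j : Fin n) :
    μ.real (Q j) = ∑ k : Fin m, if j ∈ (A k).1 then μ.real (atom Q (A k).1) else 0 := by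
  have := measure_iUnion_eq_sum_atom hQ hμ A (· = j)
  simpa using this

theorem IsCarleson.sum_le {Λ : ℝ} (h : IsCarleson μ Q Λ) (hμ : ∀ j, 0 < μ (Q j) ∧ μ (Q j) < ∞)
    (J : Finset (Fin n)) :
    ∑ j ∈ J, μ.real (Q j) / Λ ≤ μ.real (⋃ (j : Fin n) (_ : j ∈ J), Q j) := by
  have hΛ : 0 < Λ := lt_of_lt_of_le one_pos h.1
  have hfin : μ (⋃ j ∈ J, Q j) ≠ ∞ :=
    ((measure_biUnion_finset_le J Q).trans_lt (ENNReal.sum_lt_top.2 fun j _ => (hμ j).2)).ne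
  have h1 := ENNReal.toReal_mono (ENNReal.mul_ne_top ENNReal.ofReal_ne_top hfin) (h.2 J)
  rw [ENNReal.toReal_sum fun j _ => (hμ j).2.ne, ENNReal.toReal_mul,
    ENNReal.toReal_ofReal hΛ.le] at h1
  rw [← Finset.sum_div, div_le_iff₀ hΛ, mul_comm]
  exact h1

end Atoms

/-! ## Flows on the graph of a collection -/

section Flows

variable {Ω : Type*} {n : ℕ} {Q : Fin n → Set Ω}

theorem sum_vertex {R : Type*} [AddCommMonoid R] (F : Vertex Q → R) :
    ∑ v, F v = F .source + F .sink + (∑ j, F (.ofSet j) + ∑ A, F (.ofAtom A)) := by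
  rw [← (Vertex.equivSum Q).sum_comp, Fintype.sum_sum_type, Fintype.sum_sum_type,
    Fintype.sum_sum_type]
  simp [Vertex.equivSum]

variable [MeasurableSpace Ω] {μ : Measure Ω} {Λ : ℝ} {f g : Vertex Q → Vertex Q → ℝ≥0}

theorem flow_atom (hg : (graph μ Q Λ).IsFlow g) (A : {A // A ∈ P0 Q}) :
    g .source (.ofAtom A) = ∑ j, g (.ofAtom A) (.ofSet j) := by
  have h := hg.conservation (.ofAtom A) (by simp [graph]) (by simp [graph])
  rw [sum_vertex, sum_vertex] at h
  rw [hg.eq_zero .sink (.ofAtom A) id, hg.eq_zero (.ofAtom A) .source id,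
    hg.eq_zero (.ofAtom A) .sink id, Finset.sum_eq_zero fun j _ => hg.eq_zero (.ofSet j) _ id,
    Finset.sum_eq_zero fun B _ => hg.eq_zero (.ofAtom B) (.ofAtom A) id,
    Finset.sum_eq_zero fun B _ => hg.eq_zero (.ofAtom A) (.ofAtom B) id] at h
  simpa using h

theorem flow_set (hg : (graph μ Q Λ).IsFlow g) (j : Fin n) :
    g (.ofSet j) .sink = ∑ A, g (.ofAtom A) (.ofSet j) := by
  have h := hg.conservation (.ofSet j) (by simp [graph]) (by simp [graph])
  rw [sum_vertex, sum_vertex] at h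
  rw [hg.eq_zero .source (.ofSet j) id, hg.eq_zero .sink (.ofSet j) id,
    hg.eq_zero (.ofSet j) .source id,
    Finset.sum_eq_zero fun i _ => hg.eq_zero (.ofSet i) (.ofSet j) id,
    Finset.sum_eq_zero fun i _ => hg.eq_zero (.ofSet j) (.ofSet i) id,
    Finset.sum_eq_zero fun B _ => hg.eq_zero (.ofSet j) (.ofAtom B) id] at h
  simpa using h.symm

/-- The value is moved from the source to the sink because the edges into the sink are the ones that
can all be filled. -/
theorem flow_value (hg : (graph μ Q Λ).IsFlow g) :
    (graph μ Q Λ).value g = ∑ j, g (.ofSet j) .sink := by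
  have h : (graph μ Q Λ).value g = ∑ v, g .source v := rfl
  rw [h, sum_vertex, hg.eq_zero .source .source id, hg.eq_zero .source .sink id,
    Finset.sum_eq_zero fun j _ => hg.eq_zero .source (.ofSet j) id]
  simp only [zero_add, flow_atom hg, flow_set hg]
  exact Finset.sum_comm

theorem flow_not_mem (hg : (graph μ Q Λ).IsFlow g) {A : {A // A ∈ P0 Q}} {j : Fin n}
    (hj : j ∉ A.1) : g (.ofAtom A) (.ofSet j) = 0 :=
  hg.eq_zero _ _ hj

theorem flow_le_atom (hg : (graph μ Q Λ).IsFlow g) (A : {A // A ∈ P0 Q}) :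
    ((∑ j, g (.ofAtom A) (.ofSet j) : ℝ≥0) : ℝ≥0∞) ≤ μ (atom Q A.1) := by
  rw [← flow_atom hg]
  exact hg.le_cap .source (.ofAtom A) trivial

/-- The flow fills all edges that end in the sink. -/
def Saturates (μ : Measure Ω) (Λ : ℝ) (g : Vertex Q → Vertex Q → ℝ≥0) : Prop :=
  ∀ j, (g (.ofSet j) .sink : ℝ≥0∞) = ENNReal.ofReal Λ⁻¹ * μ (Q j)

theorem flow_le_of_saturates (hf : Saturates μ Λ f) (hg : (graph μ Q Λ).IsFlow g) (j : Fin n) :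
    g (.ofSet j) .sink ≤ f (.ofSet j) .sink := by
  rw [← ENNReal.coe_le_coe, hf j]
  exact hg.le_cap (.ofSet j) .sink trivial

theorem Saturates.isMaxFlow (hf : Saturates μ Λ f) (hf' : (graph μ Q Λ).IsFlow f) :
    (graph μ Q Λ).IsMaxFlow f := by
  refine ⟨hf', fun g hg => ?_⟩
  rw [flow_value hg, flow_value hf']
  exact Finset.sum_le_sum fun j _ => flow_le_of_saturates hf hg j

/-- No flow exceeds `f` on an edge into the sink, so a flow whose value is at least that of `f`
agrees with `f` on each of them. -/
theorem saturates_of_isMaxFlow (hf : Saturates μ Λ f) (hf' : (graph μ Q Λ).IsFlow f)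
    (hg : (graph μ Q Λ).IsMaxFlow g) : Saturates μ Λ g := by
  have hle := fun j => flow_le_of_saturates hf hg.1 j
  have hsum : ∑ j, g (.ofSet j) .sink = ∑ j, f (.ofSet j) .sink := by
    refine le_antisymm (Finset.sum_le_sum fun j _ => hle j) ?_
    rw [← flow_value hg.1, ← flow_value hf']
    exact hg.2 f hf'
  have heq := (Finset.sum_eq_sum_iff_of_le fun j _ => hle j).1 hsum
  intro j
  rw [heq j (Finset.mem_univ j)]
  exact hf j

/-- With the condition `j ∈ A` dropped, the sums over `j` and over the atoms can be exchanged. -/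
theorem phi_eq (hg : (graph μ Q Λ).IsFlow g) (j : Fin n) (x : Ω) :
    phi μ Q g j x = ∑ A : {A // A ∈ P0 Q},
      (g (.ofAtom A) (.ofSet j) : ℝ) / μ.real (atom Q A.1) * (atom Q A.1).indicator 1 x := by
  rw [phi, Finset.sum_filter]
  refine Finset.sum_congr rfl fun A _ => ?_
  split_ifs with h
  · rfl
  · rw [flow_not_mem hg h]; simp

theorem phi_nonneg (j : Fin n) (x : Ω) : 0 ≤ phi μ Q g j x :=
  Finset.sum_nonneg fun _ _ => mul_nonneg (div_nonneg NNReal.zero_le_coe measureReal_nonneg)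
    (Set.indicator_nonneg (fun _ _ => zero_le_one) x)

theorem measurable_phi (hQ : ∀ j, MeasurableSet (Q j)) (j : Fin n) :
    Measurable (phi μ Q g j) := by
  unfold phi
  refine Finset.measurable_sum _ fun A _ => ?_
  exact (measurable_one.indicator (measurableSet_atom hQ _)).const_mul _

theorem sum_phi_le_one (hμ : ∀ j, 0 < μ (Q j) ∧ μ (Q j) < ∞) (hg : (graph μ Q Λ).IsFlow g)
    (x : Ω) : ∑ j, phi μ Q g j x ≤ 1 := by
  simp only [phi_eq hg]
  rw [Finset.sum_comm]
  simp only [← Finset.sum_mul, ← Finset.sum_div]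
  -- At most one atom contains `x`, and there the sum is the flow through the atom divided by its
  -- mass.
  by_cases hx : ∃ A : {A // A ∈ P0 Q}, x ∈ atom Q A.1
  · obtain ⟨A, hA⟩ := hx
    rw [Finset.sum_eq_single_of_mem A (Finset.mem_univ A)]
    · rw [Set.indicator_of_mem hA, Pi.one_apply, mul_one]
      refine div_le_one_of_le₀ ?_ measureReal_nonneg
      have h := ENNReal.toReal_mono (measure_atom_lt_top hμ A.2).ne (flow_le_atom hg A)
      rw [ENNReal.coe_toReal, NNReal.coe_sum] at h
      exact h
    · intro B _ hBA
      rw [Set.indicator_of_notMem, mul_zero]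
      exact fun hB => Set.disjoint_left.1 (atom_disjoint fun h => hBA (Subtype.ext h)) hB hA
  · rw [Finset.sum_eq_zero]
    · exact zero_le_one
    · intro B _
      rw [Set.indicator_of_notMem fun hB => hx ⟨B, hB⟩, mul_zero]

/-- Each atom with `j ∈ A` lies in `Q j` and contributes its flow to `j`, since the density is
constant on the atom; conservation at `j` adds these up. -/
theorem lintegral_phi (hQ : ∀ j, MeasurableSet (Q j)) (hμ : ∀ j, 0 < μ (Q j) ∧ μ (Q j) < ∞)
    (hg : (graph μ Q Λ).IsFlow g) (j : Fin n) :
    ∫⁻ x in Q j, ENNReal.ofReal (phi μ Q g j x) ∂μ = g (.ofSet j) .sink := by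
  have hterm : ∀ (A : {A // A ∈ P0 Q}) (x : Ω), ENNReal.ofReal
      ((g (.ofAtom A) (.ofSet j) : ℝ) / μ.real (atom Q A.1) * (atom Q A.1).indicator 1 x)
      = (atom Q A.1).indicator
        (fun _ => ENNReal.ofReal ((g (.ofAtom A) (.ofSet j) : ℝ) / μ.real (atom Q A.1))) x := by
    intro A x
    by_cases hx : x ∈ atom Q A.1 <;> simp [hx]
  have hfun : ∀ x, ENNReal.ofReal (phi μ Q g j x) = ∑ A : {A // A ∈ P0 Q},
      (atom Q A.1).indicator
        (fun _ => ENNReal.ofReal ((g (.ofAtom A) (.ofSet j) : ℝ) / μ.real (atom Q A.1))) x := by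
    intro x
    rw [phi_eq hg, ENNReal.ofReal_sum_of_nonneg]
    · exact Finset.sum_congr rfl fun A _ => hterm A x
    · exact fun A _ => mul_nonneg (div_nonneg NNReal.zero_le_coe measureReal_nonneg)
        (Set.indicator_nonneg (fun _ _ => zero_le_one) x)
  simp only [hfun]
  rw [lintegral_finsetSum _ fun A _ => measurable_const.indicator (measurableSet_atom hQ _),
    flow_set hg, ENNReal.ofNNReal_finsetSum]
  refine Finset.sum_congr rfl fun A _ => ?_
  rw [lintegral_indicator_const (measurableSet_atom hQ _),
    Measure.restrict_apply (measurableSet_atom hQ _)]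
  by_cases hj : j ∈ A.1
  · rw [Set.inter_eq_left.2 fun x hx => (mem_atom_iff.1 hx j).2 hj]
    have hfin := (measure_atom_lt_top hμ A.2).ne
    -- A null atom receives nothing from the source, so no flow is lost by reading `0 / 0` as `0`.
    by_cases h0 : μ (atom Q A.1) = 0
    · have h1 := flow_le_atom hg A
      rw [h0, nonpos_iff_eq_zero, ENNReal.coe_eq_zero, Finset.sum_eq_zero_iff] at h1
      rw [h1 j (Finset.mem_univ j), h0]; simp
    · have hpos : 0 < μ.real (atom Q A.1) := ENNReal.toReal_pos h0 hfin
      rw [← ENNReal.ofReal_toReal hfin, ← ENNReal.ofReal_mul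
        (div_nonneg NNReal.zero_le_coe measureReal_nonneg)]
      change ENNReal.ofReal (_ * μ.real _) = _
      rw [div_mul_cancel₀ _ hpos.ne', ENNReal.ofReal_coe_nnreal]
  · rw [flow_not_mem hg hj]; simp

theorem Saturates.isSparseWitness (hQ : ∀ j, MeasurableSet (Q j))
    (hμ : ∀ j, 0 < μ (Q j) ∧ μ (Q j) < ∞) (hg : (graph μ Q Λ).IsFlow g)
    (hs : Saturates μ Λ g) : IsSparseWitness μ Q (1 / Λ) (phi μ Q g) where
  measurable := measurable_phi hQ
  mem_Icc j x := ⟨phi_nonneg j x, (Finset.single_le_sum (f := fun j => phi μ Q g j x)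
    (fun i _ => phi_nonneg i x) (Finset.mem_univ j)).trans (sum_phi_le_one hμ hg x)⟩
  le_integral j := by
    rw [lintegral_phi hQ hμ hg, hs j, one_div]
  sum_le_one := sum_phi_le_one hμ hg

/-- The flow that sends `y k j` from the atom `A k` to the set `j`. -/
noncomputable def flowOf {m : ℕ} (A : Fin m ≃ {A // A ∈ P0 Q}) (y : Fin m → Fin n → ℝ≥0) :
    Vertex Q → Vertex Q → ℝ≥0
  | .source, .ofAtom B => ∑ j, y (A.symm B) j
  | .ofAtom B, .ofSet j => y (A.symm B) j
  | .ofSet j, .sink => ∑ k, y k j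
  | _, _ => 0

theorem flowOf_isFlow {m : ℕ} {A : Fin m ≃ {A // A ∈ P0 Q}} {y : Fin m → Fin n → ℝ≥0}
    (hmem : ∀ k j, j ∉ (A k).1 → y k j = 0)
    (hatom : ∀ k, ((∑ j, y k j : ℝ≥0) : ℝ≥0∞) ≤ μ (atom Q (A k).1))
    (hset : ∀ j, ((∑ k, y k j : ℝ≥0) : ℝ≥0∞) = ENNReal.ofReal Λ⁻¹ * μ (Q j)) :
    (graph μ Q Λ).IsFlow (flowOf A y) := by
  refine ⟨?_, ?_, ?_⟩
  · rintro (_ | _ | i | B) (_ | _ | j | C) h <;> try rfl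
    · exact absurd trivial h
    · exact absurd trivial h
    · exact hmem _ _ (by rw [Equiv.apply_symm_apply]; exact h)
  · rintro (_ | _ | i | B) h1 h2
    · exact absurd rfl h1
    · exact absurd rfl h2
    · rw [sum_vertex, sum_vertex]
      simp only [flowOf, Finset.sum_const_zero, add_zero, zero_add]
      exact A.symm.sum_comp fun k => y k i
    · rw [sum_vertex, sum_vertex]
      simp [flowOf]
  · rintro (_ | _ | i | B) (_ | _ | j | C) h
    any_goals exact absurd h id
    · have := hatom (A.symm C)
      rwa [Equiv.apply_symm_apply] at this
    · exact (hset i).le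
    · exact le_top

end Flows

/-! ## The theorem -/

section Main

variable {Ω : Type*} [MeasurableSpace Ω] {μ : Measure Ω} {n : ℕ} {Q : Fin n → Set Ω} {Λ : ℝ}

/-- A family indexed by the numbers below `m`, continued by a default value. -/
def extendFin {α : Type*} {m : ℕ} (d : α) (F : Fin m → α) (k : ℕ) : α :=
  if h : k < m then F ⟨k, h⟩ else d

theorem extendFin_val {α : Type*} {m : ℕ} (d : α) (F : Fin m → α) (k : Fin m) :
    extendFin d F k = F k := by
  simp [extendFin]

theorem forall_lt_iff_fin {m : ℕ} {p : ℕ → Prop} : (∀ k < m, p k) ↔ ∀ k : Fin m, p k :=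
  ⟨fun h k => h k k.2, fun h k hk => h ⟨k, hk⟩⟩

/-- This carries the analysis of the program from natural numbers and abstract weights over to the
atoms of a measure space. It serves both as the existence proof and as the statement about the
algorithm. -/
theorem exists_exec_transport (hQ : ∀ j, MeasurableSet (Q j))
    (hμ : ∀ j, 0 < μ (Q j) ∧ μ (Q j) < ∞) (hcar : IsCarleson μ Q Λ) (hn : 0 < n) {m : ℕ}
    (A : Fin m ≃ {A // A ∈ P0 Q}) :
    0 < m ∧ ∃ (s : State) (t : ℕ),
      Exec (unionOracle μ Q) mainProg (inputState (fun k => (A k).1) Λ) s t (m + 1) ∧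
      t ≤ 20000 * (n ^ 2 * m + n * m ^ 2) ∧
      ∃ y : Fin m → Fin n → ℝ≥0, (∀ k j, j ∉ (A k).1 → y k j = 0) ∧
        (∀ k, ((∑ j, y k j : ℝ≥0) : ℝ≥0∞) ≤ μ (atom Q (A k).1)) ∧
        (∀ j, ((∑ k, y k j : ℝ≥0) : ℝ≥0∞) = ENNReal.ofReal Λ⁻¹ * μ (Q j)) ∧
        ∀ (k : Fin m) (j : Fin n),
          s.realArr 0 ((k : ℕ) * n + j) = y k j / μ.real (atom Q (A k).1) := by
  classical
  have hΛ : 0 < Λ := lt_of_lt_of_le one_pos hcar.1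
  -- A set of positive measure has a point, and the atom of that point is on the list.
  have hm : 0 < m := by
    obtain ⟨x, hx⟩ := nonempty_of_measure_ne_zero (hμ ⟨0, hn⟩).1.ne'
    obtain ⟨B, hB, -⟩ := exists_mem_atom hx
    exact (A.symm ⟨B, hB⟩).pos
  set A' : ℕ → Finset ℕ := extendFin ∅ fun k => (A k).1.map Fin.valEmbedding with hA'
  set c : ℕ → ℝ := extendFin 0 fun k => μ.real (atom Q (A k).1) with hc
  have cval : ∀ k : Fin m, c k = μ.real (atom Q (A k).1) := fun k => extendFin_val _ _ k
  have Aval : ∀ k : Fin m, A' k = (A k).1.map Fin.valEmbedding := fun k => extendFin_val _ _ k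
  have Amem : ∀ (k : Fin m) (j : Fin n), (j : ℕ) ∈ A' k ↔ j ∈ (A k).1 := fun k j => by
    rw [Aval]
    exact Finset.mem_map' Fin.valEmbedding
  have hsub : ∀ k < m, A' k ⊆ Finset.range n := forall_lt_iff_fin.2 fun k j hj => by
    rw [Aval, Finset.mem_map] at hj
    obtain ⟨i, -, rfl⟩ := hj
    exact Finset.mem_range.2 i.2
  have hO : IsUnionOracle m A' c (unionOracle μ Q) := by
    intro flags
    rw [unionOracle, measure_iUnion_eq_sum_atom hQ hμ A, Finset.sum_filter, Finset.sum_range]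
    refine Finset.sum_congr rfl fun k _ => ?_
    rw [cval]
    refine if_congr ?_ rfl rfl
    rw [Aval]
    simp
  have hdem : ∀ j : Fin n, ∑ k ∈ (Finset.range m).filter (fun k => (j : ℕ) ∈ A' k), c k / Λ
      = μ.real (Q j) / Λ := by
    intro j
    rw [← Finset.sum_div, Finset.sum_filter, Finset.sum_range, measure_set_eq_sum_atom hQ hμ A]
    congr 1
    refine Finset.sum_congr rfl fun k _ => ?_
    rw [cval]
    exact if_congr (Amem k j) rfl rfl
  have hall : ∀ J ⊆ Finset.range n,
      ∑ j ∈ J, ∑ k ∈ (Finset.range m).filter (fun k => j ∈ A' k), c k / Λ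
        ≤ ∑ k ∈ (Finset.range m).filter (fun k => ∃ j ∈ A' k, j ∈ J), c k := by
    intro J hJ
    have h1 := hcar.sum_le hμ (Finset.univ.filter fun j : Fin n => (j : ℕ) ∈ J)
    rw [measure_iUnion_eq_sum_atom hQ hμ A, Finset.sum_filter] at h1
    rw [← filter_range_mem_of_subset hJ, Finset.sum_filter, Finset.sum_range]
    simp only [hdem]
    refine h1.trans_eq ?_
    rw [Finset.sum_filter, Finset.sum_range]
    refine Finset.sum_congr rfl fun k _ => ?_
    rw [cval]
    refine if_congr ?_ rfl rfl
    rw [filter_range_mem_of_subset hJ, Aval]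
    simp
  obtain ⟨s, t, q, hexec, rfl, ht, x, hx0, hxmem, hxatom, hxset, hout⟩ := runs_mainProg hn hm hO
    hsub (forall_lt_iff_fin.2 fun k => by
      rw [Aval, Finset.map_nonempty]; exact (mem_P0_iff.1 (A k).2).1)
    (forall_lt_iff_fin.2 fun k => forall_lt_iff_fin.2 fun l h => by
      rw [Aval, Aval, Finset.map_inj] at h
      rw [A.injective (Subtype.ext h)])
    (forall_lt_iff_fin.2 fun k => by rw [cval]; exact measureReal_nonneg) hΛ hall
    (s := inputState (fun k => (A k).1) Λ) (by simp [inputState]) (by simp [inputState])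
    (forall_lt_iff_fin.2 fun k => forall_lt_iff_fin.2 fun j => by
      simp only [inputState, true_and]
      refine if_congr ?_ rfl rfl
      rw [Amem]
      constructor
      · rintro ⟨k', j', h, hj'⟩
        obtain ⟨h1, h2⟩ := addr_inj j.2 j'.2 h
        rwa [Fin.ext h1, Fin.ext h2]
      · exact fun h => ⟨k, j, rfl, h⟩)
    (fun a ha => by simp [inputState, ha]) (by simp [inputState]) (by simp [inputState])
    (fun a => rfl)
  let y : Fin m → Fin n → ℝ≥0 := fun k j => (x k j).toNNReal
  have hy : ∀ k j, (y k j : ℝ) = x k j := fun k j => Real.coe_toNNReal _ (hx0 k k.2 j j.2)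
  refine ⟨hm, s, t, hexec, ht, y, fun k j hj => ?_, fun k => ?_, fun j => ?_, fun k j => ?_⟩
  · exact NNReal.coe_injective ((hy k j).trans (hxmem k k.2 j j.2 fun h => hj ((Amem k j).1 h)))
  · rw [← ENNReal.toReal_le_toReal ENNReal.coe_ne_top (measure_atom_lt_top hμ (A k).2).ne,
      ENNReal.coe_toReal, NNReal.coe_sum]
    have := hxatom k k.2
    rw [Finset.sum_range, cval] at this
    simp only [hy]
    exact this
  · rw [← ENNReal.toReal_eq_toReal_iff' ENNReal.coe_ne_top
      (ENNReal.mul_ne_top ENNReal.ofReal_ne_top (hμ j).2.ne), ENNReal.coe_toReal, NNReal.coe_sum,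
      ENNReal.toReal_mul, ENNReal.toReal_ofReal (inv_nonneg.2 hΛ.le)]
    have := hxset j j.2
    rw [Finset.sum_range, hdem] at this
    rw [mul_comm, ← div_eq_mul_inv]
    simp only [hy]
    exact this
  · rw [hout k k.2 j j.2, cval, hy]

/-- The flow is what the program computes from an arbitrary listing of `P0 Q`. The empty collection,
for which the program is not analysed, is handled by the zero flow. -/
theorem exists_saturates (hQ : ∀ j, MeasurableSet (Q j))
    (hμ : ∀ j, 0 < μ (Q j) ∧ μ (Q j) < ∞) (hcar : IsCarleson μ Q Λ) :
    ∃ f : Vertex Q → Vertex Q → ℝ≥0, (graph μ Q Λ).IsFlow f ∧ Saturates μ Λ f := by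
  rcases Nat.eq_zero_or_pos n with rfl | hn
  · exact ⟨fun _ _ => 0, ⟨fun _ _ _ => rfl, fun _ _ _ => by simp, fun _ _ _ => by simp⟩,
      fun j => j.elim0⟩
  · obtain ⟨-, s, t, -, -, y, h1, h2, h3, -⟩ :=
      exists_exec_transport hQ hμ hcar hn (P0 Q).equivFin.symm
    exact ⟨flowOf _ y, flowOf_isFlow h1 h2 h3, h3⟩

theorem outputFun_eq_phi {m : ℕ} {A : Fin m ≃ {A // A ∈ P0 Q}} {y : Fin m → Fin n → ℝ≥0}
    {s : State} (hf : (graph μ Q Λ).IsFlow (flowOf A y))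
    (hs : ∀ (k : Fin m) (j : Fin n),
      s.realArr 0 ((k : ℕ) * n + j) = y k j / μ.real (atom Q (A k).1)) (j : Fin n) :
    outputFun Q (fun k => (A k).1) s j = phi μ Q (flowOf A y) j := by
  funext x
  rw [phi_eq hf, outputFun, ← A.sum_comp]
  refine Finset.sum_congr rfl fun k _ => ?_
  rw [hs]
  simp only [flowOf, Equiv.symm_apply_apply]

end Main

end CarlesonFlow

open CarlesonFlow
theorem theorem3p6 :
    ∃ (prog : Prog) (C : ℝ),
      ∀ {Ω : Type*} [MeasurableSpace Ω] (μ : Measure Ω) (n : ℕ) (Q : Fin n → Set Ω) (Λ : ℝ),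
        (∀ j, MeasurableSet (Q j)) → (∀ j, 0 < μ (Q j) ∧ μ (Q j) < ∞) → IsCarleson μ Q Λ →
        -- a maximum flow exists, and each one gives functions as required
        (∃ f, (graph μ Q Λ).IsMaxFlow f) ∧
        (∀ f, (graph μ Q Λ).IsMaxFlow f → IsSparseWitness μ Q (1 / Λ) (phi μ Q f)) ∧
        IsGeneralizedSparse μ Q (1 / Λ) ∧
        -- the functions of a maximum flow are computed by `prog` within the time bound, for each
        -- listing `A` of the given collection `P0 Q` and each time `EO` of an oracle call
        (0 < n → ∀ A : Fin (P0 Q).card ≃ {A // A ∈ P0 Q},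
          ∃ (s : State) (steps calls : ℕ),
            Exec (unionOracle μ Q) prog (inputState (fun k => (A k).1) Λ) s steps calls ∧
            (∃ f, (graph μ Q Λ).IsMaxFlow f ∧
              ∀ j, outputFun Q (fun k => (A k).1) s j = phi μ Q f j) ∧
            ∀ EO : ℝ, 0 ≤ EO →
              (calls : ℝ) * EO + steps ≤
                C * ((P0 Q).card * EO + (n : ℝ) ^ 2 * (P0 Q).card
                  + (n : ℝ) * ((P0 Q).card : ℝ) ^ 2)) := by
  refine ⟨mainProg, 20000, fun {Ω} _ μ n Q Λ hQ hμ hcar => ?_⟩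
  obtain ⟨f, hf, hsat⟩ := exists_saturates hQ hμ hcar
  have hwit : ∀ f, (graph μ Q Λ).IsMaxFlow f → IsSparseWitness μ Q (1 / Λ) (phi μ Q f) :=
    fun g hg => (saturates_of_isMaxFlow hsat hf hg).isSparseWitness hQ hμ hg.1
  have hΛ : 0 < Λ := lt_of_lt_of_le one_pos hcar.1
  refine ⟨⟨f, hsat.isMaxFlow hf⟩, hwit, ⟨one_div_pos.2 hΛ, ?_, _, hwit f (hsat.isMaxFlow hf)⟩, ?_⟩
  · rw [div_le_one hΛ]; exact hcar.1
  intro hn A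
  obtain ⟨hm, s, t, hexec, ht, y, h1, h2, h3, h4⟩ := exists_exec_transport hQ hμ hcar hn A
  have hflow := flowOf_isFlow h1 h2 h3
  refine ⟨s, t, _, hexec, ⟨flowOf A y, Saturates.isMaxFlow h3 hflow, outputFun_eq_phi hflow h4⟩,
    fun EO hEO => ?_⟩
  have ht' : (t : ℝ) ≤ 20000 * ((n : ℝ) ^ 2 * (P0 Q).card + (n : ℝ) * ((P0 Q).card : ℝ) ^ 2) := by
    exact_mod_cast ht
  have hm' : (1 : ℝ) ≤ (P0 Q).card := by exact_mod_cast hm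
  -- The additional call, for the total mass, is absorbed because there is at least one atom.
  have hcalls : ((P0 Q).card + 1 : ℝ) * EO ≤ 20000 * ((P0 Q).card * EO) := by
    rw [← mul_assoc]
    exact mul_le_mul_of_nonneg_right (by linarith) hEO
  push_cast
  linarith
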